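/- Let $\gamma\subset\mathbb{R}^2$ be a regular dodecagon (a closed convex polygon with interior, of arbitrary size and position). The outer billiard map $T$ with table $\gamma$ is defined as follows: for a point $p\notin\gamma$, draw from $p$ the right tangent to $\gamma$, i.e. the ray from $p$ that meets $\gamma$ and has $\gamma$ on its left side; if this ray meets $\gamma$ in exactly one point $v$, then $T(p)=2v-p$ is the point symmetric to $p$ with respect to $v$; otherwise $T(p)$ is undefined. A point $p\notin\gamma$ is called periodic if there is an integer $n\ge 1$ such that $T^n(p)$ is defined and $T^n(p)=p$. **Theorem 2.** For the outer billiard outside a regular dodecagon $\gamma$, the periodic points form a set of full Lebesgue measure in the complement of the table: the set of points $p\in\mathbb{R}^2\setminus\gamma$ that are not periodic has Lebesgue measure $0$. -/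

import Mathlib

/-!
Outer billiards in the plane, which is identified with the complex numbers.
-/

namespace OuterBilliard

/-- The oriented area of the parallelogram spanned by the plane vectors `a` and `b`. It is
positive exactly when `b` points strictly to the left of `a`. -/
def cross (a b : ℂ) : ℝ := a.re * b.im - a.im * b.re

/-- The point `v` is the (unique) point where the right tangent from `p` touches the figure `γ`:
`v` belongs to `γ`, and all the other points of `γ` lie strictly to the left of the ray that
starts at `p` and passes through `v`. -/
def IsRightTangencyPoint (γ : Set ℂ) (p v : ℂ) : Prop :=
  v ∈ γ ∧ ∀ w ∈ γ, w ≠ v → 0 < cross (v - p) (w - p)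

theorem IsRightTangencyPoint.unique {γ : Set ℂ} {p v v' : ℂ}
    (h : IsRightTangencyPoint γ p v) (h' : IsRightTangencyPoint γ p v') : v = v' := by
  by_contra hne
  have h1 := h.2 v' h'.1 (Ne.symm hne)
  have h2 := h'.2 v h.1 hne
  unfold cross at h1 h2
  linarith

/-- The outer billiard map with table `γ`, as a partial map of the plane. It is defined at those
points `p` outside `γ` whose right tangent to `γ` touches `γ` at exactly one point `v`, and it
sends `p` to the point symmetric to `p` with respect to `v`. -/
noncomputable def outerBilliard (γ : Set ℂ) : ℂ → Part ℂ := fun p =>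
  ⟨p ∉ γ ∧ ∃ v, IsRightTangencyPoint γ p v, fun h => 2 * h.2.choose - p⟩

theorem mem_outerBilliard {γ : Set ℂ} {p q : ℂ} :
    q ∈ outerBilliard γ p ↔ p ∉ γ ∧ ∃ v, IsRightTangencyPoint γ p v ∧ q = 2 * v - p := by
  constructor
  · rintro ⟨h, rfl⟩
    exact ⟨h.1, h.2.choose, h.2.choose_spec, rfl⟩
  · rintro ⟨hp, v, hv, rfl⟩
    refine ⟨⟨hp, v, hv⟩, ?_⟩
    have e := (Exists.choose_spec (⟨v, hv⟩ : ∃ v, IsRightTangencyPoint γ p v)).unique hv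
    change 2 * Exists.choose _ - p = 2 * v - p
    rw [e]

/-- The `n`-th iterate of a partial map; it is defined at `p` when the map can be applied `n` times
in succession, starting from `p`. -/
def iter (T : ℂ → Part ℂ) : ℕ → ℂ → Part ℂ
  | 0, p => Part.some p
  | n + 1, p => (iter T n p).bind T

/-- The point `p` is periodic for the outer billiard with table `γ`: for some `n ≥ 1` the `n`-th
iterate of the map is defined at `p` and equal to `p`. (Such a point lies outside `γ`.) -/
def IsPeriodic (γ : Set ℂ) (p : ℂ) : Prop :=
  ∃ n : ℕ, 0 < n ∧ p ∈ iter (outerBilliard γ) n p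

/-- The closed regular dodecagon with center `c` and with `c + a` as one of its vertices. -/
noncomputable def regularDodecagon (c a : ℂ) : Set ℂ :=
  convexHull ℝ (Set.range fun k : Fin 12 =>
    c + a * Complex.exp (2 * Real.pi * Complex.I * (k : ℕ) / 12))

end OuterBilliard

/-!
By similarity, the table may be taken to be the dodecagon with center `0` and inradius `1`, and
almost every point is generic: its heights in the twelve directions are transcendental, so that its
orbit never meets a discontinuity. The map commutes with the rotations of the table, and every
generic orbit can be rotated into the half-strip between the extensions of two parallel sides.
There, up to rotations, an iterate of the map turns the cell with center `4 * n` by `π / 6` about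
this center. The points of the cell in a translate of the table stay there and have finite orbits.
The remaining points form two opposite horns, and on the horns of all cells the dynamics is that of
a single piecewise isometry `hornMap`, which does not depend on `n`.

The horn is self-similar: the homothety about its tip with ratio `7 - 4 * √3` carries the orbits of
`hornMap` to subsequences of orbits near the tip, so that it preserves the finiteness of orbits, and
every generic orbit is finite or enters the image of the horn in fewer than `89` steps. Both facts
concern finitely many polygons with vertices in `ℤ[√3][ω]`, where `ω` is a primitive twelfth root of
unity, and are decided by computation. Hence the set `W` of the generic points of the horn with
infinite orbits is covered by `89` preimages of a copy of `W` whose area is `(7 - 4 * √3) ^ 2` times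
that of `W`. As `hornMap` is injective, and isometric on two pieces, this bounds the area of `W` by
`89 * (7 - 4 * √3) ^ 2 < 1` times itself, so that `W` is null.
-/

namespace OuterBilliard

open Function MeasureTheory

/-! ### Finite orbits -/

/-- The orbit of `x` is eventually periodic, that is, finite. -/
def IsPreperiodic {α : Type*} (f : α → α) (x : α) : Prop := ∃ n, f^[n] x ∈ periodicPts f

namespace IsPreperiodic

variable {α : Type*} {f : α → α} {x : α}

theorem of_mem_periodicPts (h : x ∈ periodicPts f) : IsPreperiodic f x := ⟨0, h⟩

theorem of_iterate {k : ℕ} (h : IsPreperiodic f (f^[k] x)) : IsPreperiodic f x := by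
  obtain ⟨n, hn⟩ := h
  exact ⟨n + k, by rwa [iterate_add_apply]⟩

theorem of_iterate_eq {m n : ℕ} (hmn : m < n) (h : f^[m] x = f^[n] x) : IsPreperiodic f x := by
  refine ⟨m, n - m, Nat.sub_pos_of_lt hmn, ?_⟩
  rw [IsPeriodicPt, IsFixedPt, ← iterate_add_apply, Nat.sub_add_cancel hmn.le, h]

theorem map {β : Type*} {g : α → β} {f' : β → β} (hg : Semiconj g f f') (h : IsPreperiodic f x) :
    IsPreperiodic f' (g x) := by
  obtain ⟨n, hn⟩ := h
  refine ⟨n, ?_⟩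
  rw [← (hg.iterate_right n).eq]
  exact hg.mapsTo_periodicPts hn

theorem finite_range (h : IsPreperiodic f x) : (Set.range fun n => f^[n] x).Finite := by
  obtain ⟨n, p, hp, hper⟩ := h
  refine ((Set.finite_Iio (n + p)).image fun k => f^[k] x).subset ?_
  rintro _ ⟨k, rfl⟩
  rcases lt_or_ge k n with hk | hk
  · exact ⟨k, Set.mem_Iio.2 (by lia), rfl⟩
  · have hmod : f^[k] x = f^[(k - n) % p + n] x := by
      rw [iterate_add_apply, hper.iterate_mod_apply, ← iterate_add_apply, Nat.sub_add_cancel hk]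
    exact ⟨_, Set.mem_Iio.2 (by linarith [Nat.mod_lt (k - n) hp]), hmod.symm⟩

theorem of_finite_of_forall_return {S : Set α} (hS : S.Finite)
    (h : ∀ s ∈ S, IsPreperiodic f s ∨ ∃ n, 0 < n ∧ f^[n] s ∈ S) (hx : x ∈ S) :
    IsPreperiodic f x := by
  by_contra hnot
  have hvisits : {k | f^[k] x ∈ S}.Infinite := by
    refine Set.infinite_of_forall_exists_gt fun a => ?_
    induction a with
    | zero =>
      obtain ⟨n, hn, hmem⟩ := (h x hx).resolve_left hnot
      exact ⟨n, hmem, hn⟩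
    | succ a ih =>
      obtain ⟨k, hk, hak⟩ := ih
      obtain ⟨n, hn, hmem⟩ := (h _ hk).resolve_left fun hpre => hnot hpre.of_iterate
      rw [← iterate_add_apply] at hmem
      exact ⟨n + k, hmem, by lia⟩
  obtain ⟨m, -, n, -, hne, heq⟩ :=
    hvisits.exists_ne_map_eq_of_mapsTo (f := fun k => f^[k] x) (fun _ hk => hk) hS
  rcases hne.lt_or_gt with hlt | hlt
  · exact hnot (of_iterate_eq hlt heq)
  · exact hnot (of_iterate_eq hlt heq.symm)

end IsPreperiodic

/-! ### Heights in the twelve directions -/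

/-- The twelfth roots of unity, indexed by the multiples of `π / 6`. -/
noncomputable abbrev ζ : AddChar (ZMod 12) ℂ := ZMod.stdAddChar

theorem sq_sqrt_three : √3 * √3 = (3 : ℝ) := Real.mul_self_sqrt (by norm_num)

theorem lt_sqrt_three : 1.732 < √3 := Real.lt_sqrt_of_sq_lt (by norm_num)

theorem sqrt_three_lt : √3 < 1.7321 := (Real.sqrt_lt' (by norm_num)).2 (by norm_num)

theorem zeta_natCast (k : ℕ) : ζ k = Complex.exp (2 * Real.pi * Complex.I * k / 12) := by
  have h := ZMod.stdAddChar_coe (N := 12) k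
  push_cast at h
  exact h

theorem zeta_one : ζ 1 = ⟨√3 / 2, 1 / 2⟩ := by
  have h : ζ 1 = Complex.exp ((Real.pi / 6 : ℝ) * Complex.I) := by
    rw [← Nat.cast_one, zeta_natCast]
    push_cast
    ring_nf
  rw [h]
  apply Complex.ext
  · rw [Complex.exp_ofReal_mul_I_re, Real.cos_pi_div_six]
  · rw [Complex.exp_ofReal_mul_I_im, Real.sin_pi_div_six]

theorem zeta_eq_pow (k : ZMod 12) : ζ k = ζ 1 ^ k.val := by
  rw [← AddChar.map_nsmul_eq_pow, nsmul_one, ZMod.natCast_zmod_val]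

theorem zeta_one_sq : ζ 1 * ζ 1 = √3 * ζ 1 - 1 := by
  rw [zeta_one]
  apply Complex.ext
  · simp only [Complex.mul_re, Complex.sub_re, Complex.ofReal_re, Complex.ofReal_im, Complex.one_re]
    linarith [sq_sqrt_three]
  · simp only [Complex.mul_im, Complex.sub_im, Complex.ofReal_re, Complex.ofReal_im, Complex.one_im]
    ring

theorem zeta_three : ζ 3 = Complex.I := by
  rw [show (3 : ZMod 12) = (3 : ℕ) from rfl, zeta_natCast]
  convert Complex.exp_pi_div_two_mul_I using 2
  push_cast
  ring

theorem zeta_six : ζ 6 = -1 := by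
  rw [show (6 : ZMod 12) = 3 + 3 from rfl, AddChar.map_add_eq_mul, zeta_three, Complex.I_mul_I]

theorem zeta_ne_zero (k : ZMod 12) : ζ k ≠ 0 := (ζ.val_isUnit k).ne_zero

theorem zeta_neg_mul_zeta_mul (s : ZMod 12) (z : ℂ) : ζ (-s) * (ζ s * z) = z := by
  rw [← mul_assoc, ← AddChar.map_add_eq_mul, neg_add_cancel, AddChar.map_zero_eq_one, one_mul]

theorem norm_zeta (k : ZMod 12) : ‖ζ k‖ = 1 := ζ.norm_apply k

theorem conj_zeta (k : ZMod 12) : starRingEnd ℂ (ζ k) = ζ (-k) := by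
  rw [AddChar.map_neg_eq_conj]

/-- The height of a point above the line through the origin orthogonal to `ζ k`, that is, the
support functional in the direction `ζ k`. -/
noncomputable def ht (k : ZMod 12) : ℂ →L[ℝ] ℝ :=
  Complex.reCLM.comp (ContinuousLinearMap.mul ℝ ℂ (ζ (-k)))

theorem ht_apply (k : ZMod 12) (z : ℂ) : ht k z = (ζ (-k) * z).re := rfl

theorem ht_zero (z : ℂ) : ht 0 z = z.re := by
  rw [ht_apply, neg_zero, AddChar.map_zero_eq_one, one_mul]

theorem ht_three (z : ℂ) : ht 3 z = z.im := by
  rw [ht_apply, ← conj_zeta, zeta_three]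
  simp

theorem ht_zeta_mul (k s : ZMod 12) (z : ℂ) : ht k (ζ s * z) = ht (k - s) z := by
  rw [ht_apply, ht_apply, ← mul_assoc, ← AddChar.map_add_eq_mul, neg_sub, neg_add_eq_sub]

theorem ht_add_six (k : ZMod 12) (z : ℂ) : ht (k + 6) z = -ht k z := by
  rw [ht_apply, ht_apply, neg_add, AddChar.map_add_eq_mul, show (-6 : ZMod 12) = 6 from rfl,
    zeta_six]
  simp

/-- The law of sines for the three directions `k - n`, `k` and `k + m`. -/
theorem sin_mul_ht_add_sin_mul_ht (k m n : ZMod 12) (z : ℂ) :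
    (ζ m).im * ht (k - n) z + (ζ n).im * ht (k + m) z = (ζ (m + n)).im * ht k z := by
  have hn : ht (k - n) z = (ζ n * (ζ (-k) * z)).re := by
    rw [← ht_zeta_mul, ht_apply, mul_left_comm]
  have hm : ht (k + m) z = (ζ (-m) * (ζ (-k) * z)).re := by
    rw [← sub_neg_eq_add, ← ht_zeta_mul, ht_apply, mul_left_comm]
  rw [hn, hm, ht_apply, AddChar.map_add_eq_mul, ← conj_zeta m]
  simp only [Complex.mul_re, Complex.mul_im, Complex.conj_re, Complex.conj_im]
  ring

theorem isAlgebraic_zeta (k : ZMod 12) : IsAlgebraic ℚ (ζ k) := by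
  refine IsAlgebraic.of_pow (n := 12) (by norm_num) ?_
  rw [← AddChar.map_nsmul_eq_pow, show (12 : ℕ) • k = 0 from ZModModule.char_nsmul_eq_zero 12 k,
    AddChar.map_zero_eq_one]
  exact isAlgebraic_one

theorem isAlgebraic_ht {w : ℂ} (hw : IsAlgebraic ℚ w) (k : ZMod 12) : IsAlgebraic ℚ (ht k w) := by
  have hu := (isAlgebraic_zeta (-k)).mul hw
  have hu' := hu.algHom (Complex.conjAe.toAlgHom.restrictScalars ℚ)
  rw [← isAlgebraic_algebraMap_iff (RingHom.injective (algebraMap ℝ ℂ))]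
  have h : algebraMap ℝ ℂ (ht k w) = algebraMap ℚ ℂ 2⁻¹ *
      (ζ (-k) * w + starRingEnd ℂ (ζ (-k) * w)) := by
    rw [Complex.add_conj, ht_apply]
    simp
  rw [h]
  exact (isAlgebraic_algebraMap _).mul (hu.add hu')

/-- A point is generic when its heights in the twelve directions are transcendental, so that
neither it nor its images under motions with algebraic coefficients lie on the lines where the
maps below are discontinuous. -/
def Generic (z : ℂ) : Prop := ∀ k, Transcendental ℚ (ht k z)

namespace Generic

variable {z w : ℂ}

theorem ht_ne (hz : Generic z) (k : ZMod 12) {x : ℝ} (hx : IsAlgebraic ℚ x) : ht k z ≠ x := by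
  rintro rfl
  exact hz k hx

theorem zeta_mul (hz : Generic z) (s : ZMod 12) : Generic (ζ s * z) := fun k => by
  rw [ht_zeta_mul]
  exact hz (k - s)

theorem neg (hz : Generic z) : Generic (-z) := by
  simpa only [zeta_six, neg_one_mul] using hz.zeta_mul 6

theorem add (hz : Generic z) (hw : IsAlgebraic ℚ w) : Generic (z + w) := fun k h => by
  rw [map_add] at h
  exact hz k (by simpa using h.sub (isAlgebraic_ht hw k))

theorem const_sub (hz : Generic z) (hw : IsAlgebraic ℚ w) : Generic (w - z) := by
  rw [sub_eq_neg_add]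
  exact hz.neg.add hw

theorem sub_const (hz : Generic z) (hw : IsAlgebraic ℚ w) : Generic (z - w) := by
  rw [sub_eq_add_neg]
  exact hz.add hw.neg

theorem smul (hz : Generic z) {r : ℝ} (hr : IsAlgebraic ℚ r) (hr₀ : r ≠ 0) : Generic (r • z) :=
  fun k h => by
    rw [map_smul, smul_eq_mul] at h
    exact hz k (by simpa [hr₀] using hr.inv.mul h)

end Generic

/-- The map that describes the outer billiard outside the dodecagon `{z | ∀ k, ht k z ≤ 1}` up to
the rotations of that dodecagon: in the horns defined below, it is the outer billiard map followed
by a rotation. -/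
noncomputable def hornMap (z : ℂ) : ℂ :=
  if ht 1 z < 1 then ζ 1 * z else 4 - ζ 1 * z

theorem Generic.hornMap {z : ℂ} (hz : Generic z) : Generic (hornMap z) := by
  unfold OuterBilliard.hornMap
  split_ifs
  · exact hz.zeta_mul 1
  · exact (hz.zeta_mul 1).const_sub (isAlgebraic_algebraMap (4 : ℚ))

theorem Generic.hornMap_iterate {z : ℂ} (hz : Generic z) (n : ℕ) :
    Generic (OuterBilliard.hornMap^[n] z) := by
  induction n with
  | zero => exact hz
  | succ n ih =>
    rw [Function.iterate_succ_apply']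
    exact ih.hornMap

/-! ### Exact arithmetic with √3 and the twelfth roots of unity -/

section Symbolic

open QuadraticAlgebra

/-- The ring `ℤ[√3]`, in which the kernel can compute. -/
abbrev Surd : Type := ℤ√(3 : ℕ)

/-- The ring `ℤ[√3][ω]` with `ω² = √3 ω - 1`, where `ω` stands for `ζ 1`. -/
abbrev CycInt : Type := QuadraticAlgebra Surd (-1) Zsqrtd.sqrtd

/-- The real number that an element of `ℤ[√3]` stands for. -/
noncomputable def Surd.toReal : Surd →+* ℝ := Zsqrtd.toReal (Nat.cast_nonneg 3)

open Surd

theorem Surd.toReal_apply (x : Surd) : toReal x = x.re + x.im * √3 := by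
  simp [toReal, Zsqrtd.toReal]

theorem Surd.toReal_nonneg {x : Surd} (hx : 0 ≤ x) : 0 ≤ toReal x := by
  have h₃ := sq_sqrt_three
  replace hx := Zsqrtd.nonneg_iff_zero_le.2 hx
  obtain ⟨a, b, rfl | rfl | rfl⟩ := Zsqrtd.nonneg_cases hx <;> rw [toReal_apply] <;> push_cast
  · positivity
  · have h : 3 * b * b ≤ 1 * a * a := Zsqrtd.nonnegg_pos_neg.1 hx
    have h : (3 * b * b : ℝ) ≤ 1 * a * a := by exact_mod_cast h
    have : b * √3 ≤ a := le_of_sq_le_sq (by nlinarith) a.cast_nonneg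
    linarith
  · have h : 1 * a * a ≤ 3 * b * b := Zsqrtd.nonnegg_neg_pos.1 hx
    have h : (1 * a * a : ℝ) ≤ 3 * b * b := by exact_mod_cast h
    have : a ≤ b * √3 := le_of_sq_le_sq (by nlinarith) (by positivity)
    linarith

theorem Surd.toReal_mono {x y : Surd} (h : x ≤ y) : toReal x ≤ toReal y := by
  rw [← sub_nonneg, ← map_sub]
  exact toReal_nonneg (sub_nonneg.2 h)

noncomputable instance : Algebra Surd ℂ := (Complex.ofRealHom.comp toReal).toAlgebra

theorem Surd.algebraMap_eq (x : Surd) : algebraMap Surd ℂ x = toReal x := rfl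

/-- The complex number that an element of `ℤ[√3][ω]` stands for. -/
noncomputable def CycInt.toComplex : CycInt →ₐ[Surd] ℂ :=
  QuadraticAlgebra.lift ⟨ζ 1, by
    rw [zeta_one_sq, Algebra.smul_def, Algebra.smul_def, algebraMap_eq, algebraMap_eq]
    simp [toReal_apply, sub_eq_neg_add]⟩

namespace CycInt

theorem toComplex_apply (x : CycInt) : toComplex x = toReal x.re + toReal x.im * ζ 1 := by
  simp [toComplex, Algebra.smul_def, algebraMap_eq]

theorem toComplex_omega : toComplex omega = ζ 1 := by
  simp [toComplex_apply]

/-- Multiplication by `ω`. -/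
def rot (x : CycInt) : CycInt := ⟨-x.im, x.re + Zsqrtd.sqrtd * x.im⟩

theorem toComplex_rot (x : CycInt) : toComplex (rot x) = ζ 1 * toComplex x := by
  have h : rot x = omega * x := by
    rw [omega_mul_mk]
    simp [rot]
  rw [h, map_mul, toComplex_omega]

end CycInt

/-- Twice the sine of the angle of `ζ k`. -/
def chord (k : ZMod 12) : Surd := (omega ^ k.val : CycInt).im

theorem toReal_chord (k : ZMod 12) : toReal (chord k) = 2 * (ζ k).im := by
  rw [zeta_eq_pow, ← CycInt.toComplex_omega, ← map_pow, CycInt.toComplex_apply, zeta_one]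
  simp only [chord, Complex.add_im, Complex.ofReal_im, Complex.im_ofReal_mul]
  ring

namespace CycInt

/-- Twice the height in the direction `ζ k`. -/
def twiceHt (k : ZMod 12) (x : CycInt) : Surd := chord (k + 3) * x.re + chord (k + 2) * x.im

theorem toReal_twiceHt (k : ZMod 12) (x : CycInt) :
    toReal (twiceHt k x) = 2 * ht k (toComplex x) := by
  have hre (s : ZMod 12) : (ζ (-s)).re = (ζ (s + 3)).im := by
    rw [← conj_zeta, Complex.conj_re, AddChar.map_add_eq_mul, zeta_three, Complex.mul_I_im]
  have hre' : (ζ (-k + 1)).re = (ζ (k + 2)).im := by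
    rw [neg_add_eq_sub, ← neg_sub, hre, sub_add, show (1 - 3 : ZMod 12) = -2 from rfl,
      sub_neg_eq_add]
  have hz : ζ (-k) * toComplex x = toReal x.re * ζ (-k) + toReal x.im * ζ (-k + 1) := by
    rw [toComplex_apply, AddChar.map_add_eq_mul]
    ring
  rw [twiceHt, map_add, map_mul, map_mul, toReal_chord, toReal_chord, ht_apply, hz, Complex.add_re,
    Complex.re_ofReal_mul, Complex.re_ofReal_mul, hre, hre']
  ring

end CycInt

/-- The product `chord k * x` for `k ≤ 5`, in a form that the kernel evaluates quickly. -/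
def scale (k : ℕ) (x : Surd) : Surd :=
  match k with
  | 1 => x
  | 2 => ⟨3 * x.im, x.re⟩
  | 3 => x + x
  | 4 => ⟨3 * x.im, x.re⟩
  | 5 => x
  | _ => 0

theorem toReal_scale {k : ℕ} (hk : k ≤ 5) (x : Surd) :
    toReal (scale k x) = 2 * (ζ k).im * toReal x := by
  have hsqrt : (⟨3 * x.im, x.re⟩ : Surd) = Zsqrtd.sqrtd * x := by
    ext <;> simp
  have h : scale k x = chord k * x := by
    interval_cases k
    · rw [show chord (0 : ℕ) = 0 by decide, zero_mul]
      rfl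
    · rw [show chord (1 : ℕ) = 1 by decide, one_mul, scale]
    · rw [show chord (2 : ℕ) = Zsqrtd.sqrtd by decide, ← hsqrt, scale]
    · rw [show chord (3 : ℕ) = 2 by decide, two_mul, scale]
    · rw [show chord (4 : ℕ) = Zsqrtd.sqrtd by decide, ← hsqrt, scale]
    · rw [show chord (5 : ℕ) = 1 by decide, one_mul, scale]
  rw [h, map_mul, toReal_chord]

end Symbolic

/-! ### Symbolic orbits of polygons -/

open CycInt Surd

theorem zeta_im_pos {k : ℕ} (hk : 0 < k) (hk' : k < 6) : 0 < (ζ k).im := by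
  have h : ζ k = Complex.exp ((2 * Real.pi * k / 12 : ℝ) * Complex.I) := by
    rw [zeta_natCast]
    push_cast
    ring_nf
  have hk' : (k : ℝ) < 6 := by exact_mod_cast hk'
  rw [h, Complex.exp_ofReal_mul_I_im]
  exact Real.sin_pos_of_pos_of_lt_pi (by positivity) (by nlinarith [Real.pi_pos])

theorem zeta_im_nonneg {k : ℕ} (hk : k < 6) : 0 ≤ (ζ k).im := by
  rcases k.eq_zero_or_pos with rfl | h
  · simp
  · exact (zeta_im_pos h hk).le

/-- A closed half-plane `{z | 2 * ht dir z ≤ bound}` in symbolic form. -/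
structure HalfPlane where
  dir : ZMod 12
  bound : Surd

namespace HalfPlane

/-- The half-plane on the other side of the boundary line. -/
def opp (h : HalfPlane) : HalfPlane := ⟨h.dir + 6, -h.bound⟩

/-- The set of points that a symbolic half-plane stands for. -/
def toSet (h : HalfPlane) : Set ℂ := {z | 2 * ht h.dir z ≤ toReal h.bound}

theorem mem_toSet {h : HalfPlane} {z : ℂ} :
    z ∈ h.toSet ↔ 2 * ht h.dir z ≤ toReal h.bound := Iff.rfl

theorem mem_or_mem_opp (h : HalfPlane) (z : ℂ) : z ∈ h.toSet ∨ z ∈ h.opp.toSet := by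
  simp only [mem_toSet, opp, ht_add_six, map_neg, mul_neg, neg_le_neg_iff]
  exact le_total _ _

end HalfPlane

/-- The intersection of a list of half-planes. -/
def region (l : List HalfPlane) : Set ℂ := {z | ∀ h ∈ l, z ∈ h.toSet}

/-- Whether `h` contains `region l` for one of the following reasons: a half-plane in `l` is
contained in `h` with parallel boundary, or the intersection of two half-planes in `l` whose
directions enclose that of `h` is contained in `h`. -/
def implies (l : List HalfPlane) (h : HalfPlane) : Bool :=
  l.any fun f =>
    let n := (h.dir - f.dir).val
    Nat.ble n 5 && (Nat.beq n 0 && f.bound ≤ h.bound || l.any fun g =>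
      let m := (g.dir - h.dir).val
      Nat.ble 1 m && Nat.ble (m + n) 5 &&
        scale m f.bound + scale n g.bound ≤ scale (m + n) h.bound)

theorem HalfPlane.mem_of_scale_le {f g h : HalfPlane} {m n : ℕ} (hm : 1 ≤ m) (hmn : m + n ≤ 5)
    (hf : h.dir - f.dir = n) (hg : g.dir - h.dir = m)
    (hle : scale m f.bound + scale n g.bound ≤ scale (m + n) h.bound) {z : ℂ}
    (hzf : z ∈ f.toSet) (hzg : z ∈ g.toSet) : z ∈ h.toSet := by
  have hle' := toReal_mono hle
  rw [map_add, toReal_scale (by lia), toReal_scale (by lia), toReal_scale (by lia)] at hle'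
  have hsin := sin_mul_ht_add_sin_mul_ht h.dir m n z
  rw [← hf, ← hg, sub_sub_cancel, add_sub_cancel, hf, hg, ← Nat.cast_add] at hsin
  have hf' := mul_le_mul_of_nonneg_left hzf (zeta_im_nonneg (k := m) (by lia))
  have hg' := mul_le_mul_of_nonneg_left hzg (zeta_im_nonneg (k := n) (by lia))
  exact le_of_mul_le_mul_left (by linarith) (zeta_im_pos (k := m + n) (by lia) (by lia))

theorem region_subset_of_implies {l : List HalfPlane} {h : HalfPlane} (hl : implies l h) :
    region l ⊆ h.toSet := by
  intro z hz
  simp only [implies, List.any_eq_true, Bool.and_eq_true, Bool.or_eq_true, Nat.ble_eq,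
    Nat.beq_eq, decide_eq_true_eq] at hl
  obtain ⟨f, hf, -, ⟨hdir, hle⟩ | ⟨g, hg, ⟨hm, hmn⟩, hle⟩⟩ := hl
  · have hdir : h.dir = f.dir := by rwa [ZMod.val_eq_zero, sub_eq_zero] at hdir
    have hzf : 2 * ht f.dir z ≤ toReal f.bound := hz f hf
    rw [← hdir] at hzf
    exact hzf.trans (toReal_mono hle)
  · exact HalfPlane.mem_of_scale_le hm hmn (ZMod.natCast_zmod_val _).symm
      (ZMod.natCast_zmod_val _).symm hle (hz f hf) (hz g hg)

/-- Adds half-planes to the list `kept`, leaving out those that are implied by the others. -/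
def reduce (kept : List HalfPlane) : List HalfPlane → List HalfPlane
  | [] => kept
  | f :: rest =>
    if implies (kept ++ rest) f then reduce kept rest else reduce (f :: kept) rest

theorem region_subset_reduce (kept l : List HalfPlane) :
    region kept ∩ region l ⊆ region (reduce kept l) := by
  induction l generalizing kept with
  | nil => exact Set.inter_subset_left
  | cons f rest ih =>
    rintro z ⟨hkept, hl⟩
    obtain ⟨hf, hrest⟩ := List.forall_mem_cons.1 hl
    unfold reduce
    split_ifs
    · exact ih kept ⟨hkept, hrest⟩
    · exact ih (f :: kept) ⟨List.forall_mem_cons.2 ⟨hf, hkept⟩, hrest⟩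

/-- The motion `z ↦ ζ angle * z + shift` of the plane in symbolic form. -/
structure Motion where
  angle : ZMod 12
  shift : CycInt
  deriving DecidableEq

namespace Motion

/-- The map that a symbolic motion stands for. -/
noncomputable def toFun (m : Motion) (z : ℂ) : ℂ := ζ m.angle * z + toComplex m.shift

theorem toFun_one (z : ℂ) : toFun ⟨0, 0⟩ z = z := by simp [toFun]

/-- The motion followed by the branch `z ↦ ζ 1 * z` of `hornMap`. -/
def rotate (m : Motion) : Motion := ⟨m.angle + 1, rot m.shift⟩

/-- The motion followed by the branch `z ↦ 4 - ζ 1 * z` of `hornMap`. -/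
def flip (m : Motion) : Motion := ⟨m.angle + 7, 4 - rot m.shift⟩

theorem toFun_rotate (m : Motion) (z : ℂ) : m.rotate.toFun z = ζ 1 * m.toFun z := by
  rw [toFun, rotate, AddChar.map_add_eq_mul, toComplex_rot, toFun]
  ring

theorem toFun_flip (m : Motion) (z : ℂ) : m.flip.toFun z = 4 - ζ 1 * m.toFun z := by
  rw [toFun, flip, show m.angle + 7 = m.angle + 1 + 6 by ring, AddChar.map_add_eq_mul,
    AddChar.map_add_eq_mul, zeta_six, map_sub, toComplex_rot, map_ofNat toComplex 4, toFun]
  ring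

/-- The half-plane of the points `z` with `ht 1 (m.toFun z) ≤ 1`. -/
def rotationSide (m : Motion) : HalfPlane := ⟨1 - m.angle, 2 - twiceHt 1 m.shift⟩

theorem mem_rotationSide {m : Motion} {z : ℂ} :
    z ∈ m.rotationSide.toSet ↔ ht 1 (m.toFun z) ≤ 1 := by
  simp only [rotationSide, HalfPlane.mem_toSet, toFun, map_add, ht_zeta_mul,
    map_sub, toReal_twiceHt, map_ofNat]
  constructor <;> intro h <;> linarith

theorem mem_opp_rotationSide {m : Motion} {z : ℂ} :
    z ∈ m.rotationSide.opp.toSet ↔ 1 ≤ ht 1 (m.toFun z) := by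
  simp only [rotationSide, HalfPlane.opp, HalfPlane.mem_toSet, toFun, map_add,
    ht_add_six, ht_zeta_mul, map_neg, map_sub, toReal_twiceHt, map_ofNat]
  constructor <;> intro h <;> linarith

end Motion

/-- Whether the orbit under `hornMap` of each generic point of `m.toFun '' region l` satisfies
`goal` at least once in the first `n` steps. The region is split at the discontinuity of `hornMap`,
and `goal` is tested on the parts of the region that follow the same itinerary, together with the
motion along which these have travelled. -/
def leadsTo (goal : List HalfPlane → Motion → Bool) : ℕ → List HalfPlane → Motion → Bool
  | 0, _, _ => false
  | n + 1, l, m =>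
    let h := m.rotationSide
    let next := fun l m => goal l m || leadsTo goal n l m
    if implies l h then next l m.rotate
    else if implies l h.opp then next l m.flip
    else next (reduce [h] l) m.rotate && next (reduce [h.opp] l) m.flip

theorem exists_branch_of_leadsTo {goal : List HalfPlane → Motion → Bool} {n : ℕ}
    {l : List HalfPlane} {m : Motion} (h : leadsTo goal (n + 1) l m) {z : ℂ} (hz : z ∈ region l)
    (hgen : Generic (m.toFun z)) :
    ∃ l' m', (goal l' m' || leadsTo goal n l' m') ∧ z ∈ region l' ∧
      m'.toFun z = hornMap (m.toFun z) := by
  have hne : ht 1 (m.toFun z) ≠ 1 := hgen.ht_ne 1 isAlgebraic_one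
  have hrotate (hle : z ∈ m.rotationSide.toSet) : m.rotate.toFun z = hornMap (m.toFun z) := by
    rw [hornMap, if_pos ((Motion.mem_rotationSide.1 hle).lt_of_ne hne), m.toFun_rotate]
  have hflip (hle : z ∈ m.rotationSide.opp.toSet) : m.flip.toFun z = hornMap (m.toFun z) := by
    rw [hornMap, if_neg (Motion.mem_opp_rotationSide.1 hle).not_gt, m.toFun_flip]
  have hreduce {h : HalfPlane} (hh : z ∈ h.toSet) : z ∈ region (reduce [h] l) :=
    region_subset_reduce [h] l ⟨by simpa [region] using hh, hz⟩
  simp only [leadsTo] at h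
  split_ifs at h with h₁ h₂
  · exact ⟨l, _, h, hz, hrotate (region_subset_of_implies h₁ hz)⟩
  · exact ⟨l, _, h, hz, hflip (region_subset_of_implies h₂ hz)⟩
  · obtain ⟨hr, hf⟩ := Bool.and_eq_true_iff.1 h
    rcases m.rotationSide.mem_or_mem_opp z with hz' | hz'
    · exact ⟨_, _, hr, hreduce hz', hrotate hz'⟩
    · exact ⟨_, _, hf, hreduce hz', hflip hz'⟩

theorem exists_iterate_of_leadsTo {goal : List HalfPlane → Motion → Bool} {n : ℕ}
    {l : List HalfPlane} {m : Motion} (h : leadsTo goal n l m) {z : ℂ} (hz : z ∈ region l)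
    (hgen : Generic (m.toFun z)) :
    ∃ j l' m', 0 < j ∧ j ≤ n ∧ goal l' m' ∧ z ∈ region l' ∧
      hornMap^[j] (m.toFun z) = m'.toFun z := by
  induction n generalizing l m with
  | zero => simp [leadsTo] at h
  | succ n ih =>
    obtain ⟨l', m', h', hz', hm'⟩ := exists_branch_of_leadsTo h hz hgen
    rcases Bool.or_eq_true_iff.1 h' with hgoal | hnext
    · exact ⟨1, l', m', one_pos, by lia, hgoal, hz', hm'.symm⟩
    · obtain ⟨j, l'', m'', -, hjn, hgoal, hz'', hm''⟩ := ih hnext hz' (hm' ▸ hgen.hornMap)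
      refine ⟨j + 1, l'', m'', j.succ_pos, by lia, hgoal, hz'', ?_⟩
      rw [Function.iterate_succ_apply, ← hm', hm'']

/-! ### The renormalization of the horn -/

/-- The fixed point of the renormalization: the tip of the horn, at which the two lines
`ht (-3) = 1` and `ht 2 = 1` meet. -/
def CycInt.tip : CycInt := ⟨⟨2, 2⟩, -2⟩

/-- The scaling factor of the renormalization. -/
def Surd.ratio : Surd := ⟨7, -4⟩

theorem toReal_ratio : toReal ratio = 7 - 4 * √3 := by
  simp [toReal_apply, ratio, sub_eq_add_neg]

theorem toReal_ratio_pos : 0 < toReal ratio := by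
  linarith [toReal_ratio, sqrt_three_lt]

/-- The renormalization: it conjugates `hornMap` on a large part of the horn to a first return map
of `hornMap` on the image of that part. -/
noncomputable def shrink : ℂ →ᵃ[ℝ] ℂ := AffineMap.homothety (toComplex tip) (toReal ratio)

theorem shrink_apply (z : ℂ) :
    shrink z = toReal ratio • (z - toComplex tip) + toComplex tip := by
  rw [shrink, AffineMap.homothety_apply, vsub_eq_sub, vadd_eq_add]

theorem ht_shrink (k : ZMod 12) (z : ℂ) :
    ht k (shrink z) = toReal ratio * (ht k z - ht k (toComplex tip)) + ht k (toComplex tip) := by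
  rw [shrink_apply, map_add, map_smul, map_sub, smul_eq_mul]

namespace HalfPlane

/-- The image of a half-plane under the renormalization. -/
def shrink (h : HalfPlane) : HalfPlane :=
  ⟨h.dir, twiceHt h.dir tip + ratio * (h.bound - twiceHt h.dir tip)⟩

theorem shrink_mem {h : HalfPlane} {z : ℂ} (hz : z ∈ h.toSet) :
    OuterBilliard.shrink z ∈ h.shrink.toSet := by
  rw [mem_toSet] at hz
  simp only [mem_toSet, shrink, ht_shrink, map_add, map_mul, map_sub, toReal_twiceHt]
  linarith [mul_le_mul_of_nonneg_left hz toReal_ratio_pos.le]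

end HalfPlane

theorem shrink_mem_region {l : List HalfPlane} {z : ℂ} (hz : z ∈ region l) :
    shrink z ∈ region (l.map HalfPlane.shrink) := by
  intro h hh
  obtain ⟨f, hf, rfl⟩ := List.mem_map.1 hh
  exact HalfPlane.shrink_mem (hz f hf)

namespace Motion

/-- The conjugate of a motion by the renormalization. -/
def shrink (m : Motion) : Motion :=
  ⟨m.angle, algebraMap Surd CycInt (1 - ratio) * ((1 - QuadraticAlgebra.omega ^ m.angle.val) * tip)
    + algebraMap Surd CycInt ratio * m.shift⟩

theorem toFun_shrink (m : Motion) (z : ℂ) :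
    m.shrink.toFun (OuterBilliard.shrink z) = OuterBilliard.shrink (m.toFun z) := by
  simp only [toFun, shrink, shrink_apply, map_add, map_mul, map_sub, map_one, map_pow,
    toComplex_omega, ← zeta_eq_pow, AlgHom.commutes, algebraMap_eq, Complex.real_smul]
  ring

end Motion

theorem isAlgebraic_toReal (x : Surd) : IsAlgebraic ℚ (toReal x) := by
  have h : IsAlgebraic ℚ √3 :=
    .of_pow (n := 2) two_pos (by simpa using isAlgebraic_algebraMap (A := ℝ) (3 : ℚ))
  rw [toReal_apply]
  exact (isAlgebraic_intCast _).add ((isAlgebraic_intCast _).mul h)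

theorem isAlgebraic_toComplex (x : CycInt) : IsAlgebraic ℚ (toComplex x) := by
  rw [toComplex_apply]
  exact (isAlgebraic_toReal x.re).algebraMap.add
    ((isAlgebraic_toReal x.im).algebraMap.mul (isAlgebraic_zeta 1))

theorem Generic.shrink {z : ℂ} (hz : Generic z) : Generic (shrink z) := by
  rw [shrink_apply]
  exact ((hz.sub_const (isAlgebraic_toComplex tip)).smul (isAlgebraic_toReal ratio)
    toReal_ratio_pos.ne').add (isAlgebraic_toComplex tip)

/-- Whether the orbit of each generic point of `region l` follows the motion `m` at some time, and
the orbit of its renormalization follows the renormalization of `m` at some time, unless it returns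
to its starting point before. -/
def renormalizes (l : List HalfPlane) (m : Motion) : Bool :=
  leadsTo (fun _ m' => m' = m) 5 l ⟨0, 0⟩ &&
    leadsTo (fun _ m' => m' = m.shrink || m' = ⟨0, 0⟩) 84 (l.map HalfPlane.shrink) ⟨0, 0⟩

theorem exists_iterate_shrink_of_renormalizes {l : List HalfPlane} {m : Motion}
    (h : renormalizes l m) {z : ℂ} (hz : z ∈ region l) (hgen : Generic z) :
    shrink z ∈ periodicPts hornMap ∨
      ∃ i j, 0 < j ∧ hornMap^[j] (shrink z) = shrink (hornMap^[i] z) := by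
  obtain ⟨h₁, h₂⟩ := Bool.and_eq_true_iff.1 h
  obtain ⟨i, -, m₁, -, -, hm₁, -, hi⟩ :=
    exists_iterate_of_leadsTo h₁ hz (by rwa [Motion.toFun_one])
  obtain ⟨j, -, m₂, hj, -, hm₂, -, hj'⟩ := exists_iterate_of_leadsTo h₂ (shrink_mem_region hz)
    (by rw [Motion.toFun_one]; exact hgen.shrink)
  rw [Motion.toFun_one] at hi hj'
  simp only [Bool.or_eq_true, decide_eq_true_eq] at hm₁ hm₂
  rcases hm₂ with rfl | rfl
  · exact Or.inr ⟨i, j, hj, by rw [hj', m.toFun_shrink, hi, hm₁]⟩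
  · exact Or.inl ⟨j, hj, by rw [IsPeriodicPt, IsFixedPt, hj', Motion.toFun_one]⟩

/-- The cells of the horn on which the renormalization acts, each one with a motion that the
orbits of its points follow. -/
def cells : List (List HalfPlane × Motion) :=
  [([⟨1, 2⟩, ⟨6, -2⟩, ⟨-3, 2⟩], ⟨1, 0⟩),
    ([⟨0, 2⟩, ⟨5, -2⟩, ⟨-3, 2⟩], ⟨1, 0⟩),
    ([⟨4, -2⟩, ⟨-3, 2⟩, ⟨-1, 2⟩], ⟨1, 0⟩),
    ([⟨2, 2⟩, ⟨7, -2⟩, ⟨-3, 2⟩, ⟨-1, 6⟩], ⟨7, 4⟩),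
    ([⟨2, 2⟩, ⟨5, -6⟩, ⟨7, -2⟩, ⟨-3, 2⟩, ⟨-2, ⟨-2, 4⟩⟩], ⟨4, 4 - 4 * QuadraticAlgebra.omega ^ 3⟩),
    ([⟨2, 2⟩, ⟨4, ⟨2, -4⟩⟩, ⟨-3, 2⟩], ⟨5, 8 - 4 * QuadraticAlgebra.omega ^ 2⟩)]

theorem renormalizes_of_mem_cells : ∀ c ∈ cells, renormalizes c.1 c.2 := by decide +kernel

/-- The goal of the orbits in the part of the horn that is not renormalized: to return to the
starting point, or to enter the half-plane `{z | 7 - 2 * √3 ≤ ht 0 z}`, whose points in the horn lie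
in the renormalization of the horn. -/
def returnsOrDeep (l : List HalfPlane) (m : Motion) : Bool :=
  m = ⟨0, 0⟩ || implies l ⟨6 - m.angle, twiceHt 0 m.shift - ⟨14, -4⟩⟩

theorem leadsTo_returnsOrDeep :
    leadsTo returnsOrDeep 85 [⟨2, 2⟩, ⟨7, -2⟩, ⟨-3, 2⟩] ⟨0, 0⟩ := by decide +kernel

/-- The three-term recurrence `2 cos (π / 6) cos θ = cos (θ - π / 6) + cos (θ + π / 6)`. -/
theorem ht_sub_one_add_ht_add_one (k : ZMod 12) (z : ℂ) :
    ht (k - 1) z + ht (k + 1) z = √3 * ht k z := by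
  have h := sin_mul_ht_add_sin_mul_ht k 1 1 z
  have hsq : (ζ (1 + 1)).im = √3 / 2 := by
    rw [AddChar.map_add_eq_mul, zeta_one_sq, zeta_one]
    simp only [Complex.sub_im, Complex.im_ofReal_mul, Complex.one_im]
    ring
  rw [hsq, zeta_one] at h
  linarith

theorem ht_eq_of_ht_neg_three_of_ht_two (z : ℂ) :
    ht 1 z = ht (-3) z + √3 * ht 2 z ∧ ht 0 z = √3 * ht (-3) z + 2 * ht 2 z ∧
      ht (-1) z = 2 * ht (-3) z + √3 * ht 2 z ∧ ht (-2) z = √3 * ht (-3) z + ht 2 z := by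
  have h₃ : ht 3 z = -ht (-3) z := ht_add_six (-3) z
  have h₂ : ht 1 z + ht 3 z = √3 * ht 2 z := ht_sub_one_add_ht_add_one 2 z
  have h₁ : ht 0 z + ht 2 z = √3 * ht 1 z := ht_sub_one_add_ht_add_one 1 z
  have h₀ : ht (-1) z + ht 1 z = √3 * ht 0 z := ht_sub_one_add_ht_add_one 0 z
  have h₁₀ : ht (-3) z + ht (-1) z = √3 * ht (-2) z := ht_sub_one_add_ht_add_one (-2) z
  have hsq := sq_sqrt_three
  have e₁ : ht 1 z = ht (-3) z + √3 * ht 2 z := by linarith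
  have e₀ : ht 0 z = √3 * ht (-3) z + 2 * ht 2 z := by
    rw [e₁] at h₁
    linear_combination h₁ + ht 2 z * hsq
  have e₁₁ : ht (-1) z = 2 * ht (-3) z + √3 * ht 2 z := by
    rw [e₀, e₁] at h₀
    linear_combination h₀ + ht (-3) z * hsq
  refine ⟨e₁, e₀, e₁₁, ?_⟩
  rw [e₁₁] at h₁₀
  linear_combination (-√3 / 3) * h₁₀ + (ht 2 z - ht (-2) z) / 3 * hsq

/-- The region on the right of the dodecagon `{z | ∀ k, ht k z ≤ 1}` and below the extensions of
two of its sides. -/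
def Horn : Set ℂ :=
  {z | ht (-3) z < 1 ∧ ht 2 z < 1 ∧ ∃ j : ℕ, j ≤ 3 ∧ 1 < ht (1 - j) z}

namespace Horn

variable {z : ℂ}

theorem one_lt_ht (hz : z ∈ Horn) :
    1 < ht 1 z ∨ 1 < ht 0 z ∨ 1 < ht (-1) z ∨ 1 < ht (-2) z := by
  obtain ⟨j, hj, h⟩ := hz.2.2
  interval_cases j
  · exact Or.inl (by simpa using h)
  · exact Or.inr (Or.inl (by simpa using h))
  · exact Or.inr (Or.inr (Or.inl h))
  · exact Or.inr (Or.inr (Or.inr h))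

theorem neg_one_lt_ht (hz : z ∈ Horn) : -1 < ht (-3) z ∧ -1 < ht 2 z ∧ -1 < ht 1 z := by
  obtain ⟨e₁, e₀, e₁₁, e₁₀⟩ := ht_eq_of_ht_neg_three_of_ht_two z
  have h := one_lt_ht hz
  rw [e₁, e₀, e₁₁, e₁₀] at h
  rw [e₁]
  have hl := lt_sqrt_three
  have hu := sqrt_three_lt
  rcases h with h | h | h | h <;>
    exact ⟨by nlinarith [hz.1, hz.2.1], by nlinarith [hz.1, hz.2.1], by nlinarith [hz.1, hz.2.1]⟩

end Horn

theorem ht_toComplex_of_twiceHt_eq {k : ZMod 12} {x : CycInt} {y : Surd} (h : twiceHt k x = y) :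
    ht k (toComplex x) = toReal y / 2 := by
  rw [← h, toReal_twiceHt]
  ring

theorem Horn.zeta_one_mul_mem {z : ℂ} (hz : z ∈ Horn) (h : ht 1 z < 1) : ζ 1 * z ∈ Horn := by
  obtain ⟨-, hb, -⟩ := neg_one_lt_ht hz
  have h₈ : ht (-4) z = -ht 2 z := ht_add_six 2 z
  obtain ⟨j, hj, hj'⟩ := hz.2.2
  have hj₀ : j ≠ 0 := by
    rintro rfl
    rw [Nat.cast_zero, sub_zero] at hj'
    exact hj'.not_gt h
  obtain ⟨i, rfl⟩ := Nat.exists_eq_succ_of_ne_zero hj₀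
  refine ⟨?_, by rwa [ht_zeta_mul], i, by lia, ?_⟩
  · rw [ht_zeta_mul, show (-3 - 1 : ZMod 12) = -4 from rfl]
    linarith
  · rw [ht_zeta_mul]
    convert hj' using 3
    push_cast
    ring

theorem Horn.four_sub_zeta_one_mul_mem {z : ℂ} (hz : z ∈ Horn) (h : 1 < ht 1 z) :
    4 - ζ 1 * z ∈ Horn := by
  have h₈ : ht (-4) z = -ht 2 z := ht_add_six 2 z
  have e₉ := ht_toComplex_of_twiceHt_eq (k := -3) (x := 4) (y := 0) (by decide +kernel)
  have e₂ := ht_toComplex_of_twiceHt_eq (k := 2) (x := 4) (y := 4) (by decide +kernel)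
  have e₁₀ := ht_toComplex_of_twiceHt_eq (k := -2) (x := 4) (y := 4) (by decide +kernel)
  simp only [map_zero, map_ofNat] at e₉ e₂ e₁₀
  refine ⟨?_, ?_, 3, le_rfl, ?_⟩
  · rw [map_sub, e₉, ht_zeta_mul, show (-3 - 1 : ZMod 12) = -4 from rfl]
    linarith [hz.2.1]
  · rw [map_sub, e₂, ht_zeta_mul, show (2 - 1 : ZMod 12) = 1 from rfl]
    linarith
  · rw [show (1 - (3 : ℕ) : ZMod 12) = -2 from rfl, map_sub, e₁₀, ht_zeta_mul,
      show (-2 - 1 : ZMod 12) = -3 from rfl]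
    linarith [hz.1]

theorem hornMap_mem_horn {z : ℂ} (hz : z ∈ Horn) (hgen : Generic z) : hornMap z ∈ Horn := by
  rcases (hgen.ht_ne 1 isAlgebraic_one).lt_or_gt with h | h
  · rw [hornMap, if_pos h]
    exact Horn.zeta_one_mul_mem hz h
  · rw [hornMap, if_neg h.not_gt]
    exact Horn.four_sub_zeta_one_mul_mem hz h

theorem hornMap_iterate_mem_horn {z : ℂ} (hz : z ∈ Horn) (hgen : Generic z) (n : ℕ) :
    hornMap^[n] z ∈ Horn := by
  induction n with
  | zero => exact hz
  | succ n ih =>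
    rw [iterate_succ_apply']
    exact hornMap_mem_horn ih (hgen.hornMap_iterate n)

theorem Horn.exists_mem_cells {z : ℂ} (hz : z ∈ Horn) : ∃ c ∈ cells, z ∈ region c.1 := by
  have h₄ : ht 4 z = -ht (-2) z := ht_add_six (-2) z
  have h₅ : ht 5 z = -ht (-1) z := ht_add_six (-1) z
  have h₆ : ht 6 z = -ht 0 z := ht_add_six 0 z
  have h₇ : ht 7 z = -ht 1 z := ht_add_six 1 z
  have h₉ := hz.1
  have h₂ := hz.2.1
  have hcase := one_lt_ht hz
  simp only [cells, List.exists_mem_cons_iff, List.not_mem_nil, false_and, exists_false, or_false,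
    region, Set.mem_ofPred_eq, List.forall_mem_cons, List.not_mem_nil, false_imp_iff,
    implies_true, and_true, HalfPlane.mem_toSet, h₄, h₅, h₆, h₇, map_neg, map_ofNat]
  simp only [toReal_apply]
  push_cast
  rcases lt_or_ge (ht 1 z) 1 with h₁ | h₁
  · rcases lt_or_ge 1 (ht 0 z) with h₀ | h₀
    · exact Or.inl ⟨by linarith, by linarith, by linarith⟩
    rcases lt_or_ge 1 (ht (-1) z) with h₁₁ | h₁₁
    · exact Or.inr (Or.inl ⟨by linarith, by linarith, by linarith⟩)
    have h₁₀ : 1 < ht (-2) z := by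
      rcases hcase with h | h | h | h <;> first | exact h | linarith
    exact Or.inr (Or.inr (Or.inl ⟨by linarith, by linarith, by linarith⟩))
  · rcases le_total (ht (-1) z) 3 with h₁₁ | h₁₁
    · exact Or.inr (Or.inr (Or.inr (Or.inl ⟨by linarith, by linarith, by linarith, by linarith⟩)))
    rcases le_total (ht (-2) z) (2 * √3 - 1) with h₁₀ | h₁₀
    · exact Or.inr (Or.inr (Or.inr (Or.inr (Or.inl
        ⟨by linarith, by linarith, by linarith, by linarith, by linarith⟩))))
    · exact Or.inr (Or.inr (Or.inr (Or.inr (Or.inr ⟨by linarith, by linarith, by linarith⟩))))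

theorem IsPreperiodic.shrink {z : ℂ} (hz : z ∈ Horn) (hgen : Generic z)
    (h : IsPreperiodic hornMap z) : IsPreperiodic hornMap (shrink z) := by
  refine .of_finite_of_forall_return (h.finite_range.image OuterBilliard.shrink) ?_
    ⟨z, ⟨0, rfl⟩, rfl⟩
  rintro _ ⟨_, ⟨k, rfl⟩, rfl⟩
  obtain ⟨c, hc, hzc⟩ := Horn.exists_mem_cells (hornMap_iterate_mem_horn hz hgen k)
  rcases exists_iterate_shrink_of_renormalizes (renormalizes_of_mem_cells c hc) hzc
    (hgen.hornMap_iterate k) with hper | ⟨i, j, hj, hij⟩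
  · exact Or.inl (.of_mem_periodicPts hper)
  · refine Or.inr ⟨j, hj, _, ⟨i + k, rfl⟩, ?_⟩
    simp only [hij, iterate_add_apply]

theorem exists_shrink_eq (z : ℂ) : ∃ w, shrink w = z :=
  (AffineEquiv.homothetyUnitsMulHom (toComplex tip)
    (Units.mk0 (toReal ratio) toReal_ratio_pos.ne')).surjective z

theorem Generic.of_shrink {z : ℂ} (h : Generic (OuterBilliard.shrink z)) : Generic z := by
  have hz : z = (toReal ratio)⁻¹ • (OuterBilliard.shrink z - toComplex tip) + toComplex tip := by
    rw [shrink_apply, add_sub_cancel_right, inv_smul_smul₀ toReal_ratio_pos.ne', sub_add_cancel]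
  rw [hz]
  exact ((h.sub_const (isAlgebraic_toComplex tip)).smul (isAlgebraic_toReal ratio).inv
    (inv_ne_zero toReal_ratio_pos.ne')).add (isAlgebraic_toComplex tip)

theorem Horn.mem_shrink_image {z : ℂ} (hz : z ∈ Horn) (h : 7 - 2 * √3 < ht 0 z) :
    z ∈ shrink '' Horn := by
  obtain ⟨w, rfl⟩ := exists_shrink_eq z
  have e₉ := ht_toComplex_of_twiceHt_eq (k := -3) (x := tip) (y := 2) (by decide +kernel)
  have e₂ := ht_toComplex_of_twiceHt_eq (k := 2) (x := tip) (y := 2) (by decide +kernel)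
  have e₀ := ht_toComplex_of_twiceHt_eq (k := 0) (x := tip) (y := ⟨4, 2⟩) (by decide +kernel)
  have hr := toReal_ratio_pos
  obtain ⟨h₉, h₂, -⟩ := hz
  simp only [map_ofNat, ht_shrink] at e₉ e₂ h₉ h₂ h
  rw [toReal_apply] at e₀
  push_cast at e₀
  refine ⟨w, ⟨by nlinarith, by nlinarith, 1, by norm_num, ?_⟩, rfl⟩
  rw [Nat.cast_one, sub_self]
  have hlt : toReal ratio * (1 - (2 + √3)) < toReal ratio * (ht 0 w - (2 + √3)) := by
    have hsq := sq_sqrt_three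
    rw [e₀] at h
    rw [toReal_ratio] at *
    linarith
  linarith [lt_of_mul_lt_mul_left hlt hr.le]

theorem exists_iterate_mem_shrink_of_one_lt {z : ℂ} (hz : z ∈ Horn) (hgen : Generic z)
    (h : 1 < ht 1 z) :
    IsPreperiodic hornMap z ∨ ∃ j ≤ 85, hornMap^[j] z ∈ shrink '' Horn := by
  have hregion : z ∈ region [⟨2, 2⟩, ⟨7, -2⟩, ⟨-3, 2⟩] := by
    have h₇ : ht 7 z = -ht 1 z := ht_add_six 1 z
    simp only [region, Set.mem_ofPred_eq, List.forall_mem_cons, List.not_mem_nil, false_imp_iff,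
      implies_true, and_true, HalfPlane.mem_toSet, h₇, map_neg, map_ofNat]
    exact ⟨by linarith [hz.2.1], by linarith, by linarith [hz.1]⟩
  obtain ⟨j, l, m, hj, hj', hgoal, hl, hm⟩ :=
    exists_iterate_of_leadsTo leadsTo_returnsOrDeep hregion (by rwa [Motion.toFun_one])
  rw [Motion.toFun_one] at hm
  simp only [returnsOrDeep, Bool.or_eq_true, decide_eq_true_eq] at hgoal
  rcases hgoal with rfl | hdeep
  · rw [Motion.toFun_one] at hm
    exact Or.inl (.of_mem_periodicPts ⟨j, hj, hm⟩)
  · refine Or.inr ⟨j, hj', Horn.mem_shrink_image (hornMap_iterate_mem_horn hz hgen j) ?_⟩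
    have hle := region_subset_of_implies hdeep hl
    have hneg : ht (6 - m.angle) z = -ht (0 - m.angle) z := by
      rw [← ht_add_six, sub_add_eq_add_sub, zero_add]
    rw [HalfPlane.mem_toSet, map_sub, toReal_twiceHt, toReal_apply] at hle
    refine lt_of_le_of_ne ?_ ?_
    · rw [hm, Motion.toFun, map_add, ht_zeta_mul]
      push_cast at hle
      linarith
    · have hne := (hgen.hornMap_iterate j).ht_ne 0 (isAlgebraic_toReal ⟨7, -2⟩)
      simpa [toReal_apply, sub_eq_add_neg] using hne.symm

theorem Horn.exists_hornMap_iterate_eq_zeta_mul {z : ℂ} (hz : z ∈ Horn) :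
    ∃ j ≤ 3, hornMap^[j] z = ζ j * z ∧ 1 ≤ ht 1 (hornMap^[j] z) := by
  classical
  obtain ⟨l, hl, hlz⟩ := hz.2.2
  rw [← ht_zeta_mul] at hlz
  have hex : ∃ j : ℕ, 1 ≤ ht 1 (ζ j * z) := ⟨l, hlz.le⟩
  have hrotate : ∀ j ≤ Nat.find hex, hornMap^[j] z = ζ j * z := by
    intro j hj
    induction j with
    | zero => simp
    | succ j ih =>
      have hlt : ht 1 (ζ j * z) < 1 := not_le.1 (Nat.find_min hex hj)
      rw [iterate_succ_apply', ih (by lia), hornMap, if_pos hlt, Nat.cast_succ, add_comm,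
        AddChar.map_add_eq_mul, mul_assoc]
  refine ⟨_, (Nat.find_min' hex hlz.le).trans hl, hrotate _ le_rfl, ?_⟩
  rw [hrotate _ le_rfl]
  exact Nat.find_spec hex

theorem exists_iterate_mem_shrink {z : ℂ} (hz : z ∈ Horn) (hgen : Generic z) :
    IsPreperiodic hornMap z ∨ ∃ j < 89, hornMap^[j] z ∈ shrink '' Horn := by
  obtain ⟨i, hi, -, hle⟩ := Horn.exists_hornMap_iterate_eq_zeta_mul hz
  have hgen' := hgen.hornMap_iterate i
  have hlt := hle.lt_of_ne' (hgen'.ht_ne 1 isAlgebraic_one)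
  rcases exists_iterate_mem_shrink_of_one_lt (hornMap_iterate_mem_horn hz hgen i) hgen' hlt with
    hpre | ⟨j, hj, hmem⟩
  · exact Or.inl hpre.of_iterate
  · exact Or.inr ⟨j + i, by lia, by rwa [iterate_add_apply]⟩

/-! ### Infinite orbits in the horn are negligible -/

section Measure

variable {α : Type*} [MeasurableSpace α] {μ : Measure α} {f : α → α} {U : Set α}

theorem measure_inter_preimage_iterate_le (hU : Set.MapsTo f U U)
    (hf : ∀ A, μ (U ∩ f ⁻¹' A) ≤ μ A) (A : Set α) (n : ℕ) : μ (U ∩ f^[n] ⁻¹' A) ≤ μ A := by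
  induction n with
  | zero => exact measure_mono Set.inter_subset_right
  | succ n ih =>
    have hsub : U ∩ f^[n + 1] ⁻¹' A ⊆ U ∩ f ⁻¹' (U ∩ f^[n] ⁻¹' A) :=
      fun x hx => ⟨hx.1, hU hx.1, hx.2⟩
    exact (measure_mono hsub).trans ((hf _).trans ih)

theorem measure_le_mul_of_forall_exists_iterate_mem (hU : Set.MapsTo f U U)
    (hf : ∀ A, μ (U ∩ f ⁻¹' A) ≤ μ A) {A B : Set α} (hAU : A ⊆ U) {N : ℕ}
    (h : ∀ x ∈ A, ∃ n < N, f^[n] x ∈ B) : μ A ≤ N * μ B := by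
  have hcover : A ⊆ ⋃ n ∈ Finset.range N, U ∩ f^[n] ⁻¹' B := fun x hx => by
    obtain ⟨n, hn, hnB⟩ := h x hx
    exact Set.mem_biUnion (Finset.mem_coe.2 (Finset.mem_range.2 hn)) ⟨hAU hx, hnB⟩
  calc μ A ≤ ∑ n ∈ Finset.range N, μ (U ∩ f^[n] ⁻¹' B) :=
        (measure_mono hcover).trans (measure_biUnion_finset_le _ _)
    _ ≤ ∑ _n ∈ Finset.range N, μ B :=
        Finset.sum_le_sum fun n _ => measure_inter_preimage_iterate_le hU hf B n
    _ = N * μ B := by rw [Finset.sum_const, Finset.card_range, nsmul_eq_mul]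

end Measure

theorem volume_preimage_mul_add {u : ℂ} (hu : ‖u‖ = 1) (w : ℂ) (A : Set ℂ) :
    volume ((fun z => u * z + w) ⁻¹' A) = volume A := by
  have hrot : (fun z => u * z + w) ⁻¹' A =
      (rotation ⟨u, mem_sphere_zero_iff_norm.2 hu⟩).toMeasurableEquiv ⁻¹' ((· + w) ⁻¹' A) := rfl
  rw [hrot, (rotation _).measurePreserving.measure_preimage_equiv, measure_preimage_add_right]

theorem ht_surjective (k : ZMod 12) : Surjective (ht k) := fun x =>
  ⟨ζ k * x, by rw [ht_zeta_mul, sub_self, ht_apply]; simp⟩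

theorem ae_generic : ∀ᵐ z : ℂ, Generic z := by
  refine ae_all_iff.2 fun k => ?_
  have hreal : ∀ᵐ x : ℝ, Transcendental ℚ x :=
    (Algebraic.countable ℚ ℝ).ae_notMem volume
  exact (ae_comp_linearMap_mem_iff (ht k).toLinearMap volume volume (ht_surjective k)
    (Algebraic.countable ℚ ℝ).measurableSet.compl).2 hreal

theorem volume_inter_preimage_hornMap_le (A : Set ℂ) :
    volume ({z | z ∈ Horn ∧ Generic z} ∩ hornMap ⁻¹' A) ≤ volume A := by
  -- the images of the two branches are separated by the line `ht 4 = -1`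
  have hmeas : MeasurableSet {w | -1 < ht 4 w} :=
    (isOpen_lt continuous_const (ht 4).continuous).measurableSet
  have hsub : {z | z ∈ Horn ∧ Generic z} ∩ hornMap ⁻¹' A ⊆
      (fun z => ζ 1 * z + 0) ⁻¹' (A ∩ {w | -1 < ht 4 w}) ∪
      (fun z => -ζ 1 * z + 4) ⁻¹' (A \ {w | -1 < ht 4 w}) := by
    rintro z ⟨⟨hz, -⟩, hA⟩
    have h₃ : ht 3 z = -ht (-3) z := ht_add_six (-3) z
    rw [Set.mem_preimage, hornMap] at hA
    split_ifs at hA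
    · rw [← add_zero (ζ 1 * z)] at hA
      refine Or.inl ⟨hA, ?_⟩
      beta_reduce
      rw [Set.mem_ofPred_eq, add_zero, ht_zeta_mul, show (4 - 1 : ZMod 12) = 3 from rfl]
      linarith [hz.1]
    · refine Or.inr ?_
      have e₄ := ht_toComplex_of_twiceHt_eq (k := 4) (x := 4) (y := -4) (by decide +kernel)
      simp only [map_neg, map_ofNat] at e₄
      rw [Set.mem_preimage, neg_mul, neg_add_eq_sub]
      refine ⟨hA, ?_⟩
      rw [Set.mem_ofPred_eq, map_sub, e₄, ht_zeta_mul, show (4 - 1 : ZMod 12) = 3 from rfl]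
      linarith [hz.1]
  refine (measure_mono hsub).trans ((measure_union_le _ _).trans ?_)
  rw [volume_preimage_mul_add (norm_zeta 1), volume_preimage_mul_add (by rw [norm_neg, norm_zeta]),
    measure_inter_add_sdiff _ hmeas]

theorem volume_shrink_image (A : Set ℂ) :
    volume (shrink '' A) = ENNReal.ofReal (toReal ratio ^ 2) * volume A := by
  rw [shrink, Measure.addHaar_image_homothety, Complex.finrank_real_complex,
    abs_of_nonneg (sq_nonneg _)]

theorem volume_horn_lt_top : volume Horn < ⊤ := by
  have hsub : Horn ⊆ Metric.closedBall 0 6 := by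
    intro z hz
    obtain ⟨h₉, h₂, -⟩ := Horn.neg_one_lt_ht hz
    obtain ⟨-, e₀, -⟩ := ht_eq_of_ht_neg_three_of_ht_two z
    have hl := lt_sqrt_three
    have hu := sqrt_three_lt
    have him : ht 3 z = -ht (-3) z := ht_add_six (-3) z
    have : |z.re| ≤ 4 := by
      rw [← ht_zero, e₀]
      exact abs_le.2 ⟨by nlinarith [hz.1, hz.2.1], by nlinarith [hz.1, hz.2.1]⟩
    have : |z.im| ≤ 1 := by
      rw [← ht_three, him, abs_neg]
      exact abs_le.2 ⟨h₉.le, hz.1.le⟩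
    rw [mem_closedBall_zero_iff]
    linarith [Complex.norm_le_abs_re_add_abs_im z]
  exact (measure_mono hsub).trans_lt measure_closedBall_lt_top

/-- The generic points of the horn with an infinite orbit. -/
def wandering : Set ℂ := {z | z ∈ Horn ∧ Generic z ∧ ¬IsPreperiodic hornMap z}

theorem exists_iterate_mem_shrink_wandering {z : ℂ} (hz : z ∈ wandering) :
    ∃ n < 89, hornMap^[n] z ∈ shrink '' wandering := by
  obtain ⟨hmem, hgen, hpre⟩ := hz
  obtain ⟨n, hn, w, hw, hwz⟩ := (exists_iterate_mem_shrink hmem hgen).resolve_left hpre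
  have hgenw : Generic w := .of_shrink (hwz ▸ hgen.hornMap_iterate n)
  exact ⟨n, hn, w, ⟨hw, hgenw, fun h => hpre (.of_iterate (hwz ▸ h.shrink hw hgenw))⟩, hwz⟩

theorem volume_wandering : volume wandering = 0 := by
  have hle : volume wandering ≤ 89 * volume (shrink '' wandering) :=
    measure_le_mul_of_forall_exists_iterate_mem (U := {z | z ∈ Horn ∧ Generic z})
      (fun z hz => ⟨hornMap_mem_horn hz.1 hz.2, hz.2.hornMap⟩) volume_inter_preimage_hornMap_le
      (fun z hz => ⟨hz.1, hz.2.1⟩) fun z => exists_iterate_mem_shrink_wandering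
  have hfin : volume wandering ≠ ⊤ :=
    ((measure_mono fun z hz => hz.1).trans_lt volume_horn_lt_top).ne
  have hlt : 89 * ENNReal.ofReal (toReal ratio ^ 2) < 1 := by
    rw [← ENNReal.ofReal_ofNat, ← ENNReal.ofReal_mul (by norm_num), ENNReal.ofReal_lt_one,
      toReal_ratio]
    nlinarith [lt_sqrt_three, sqrt_three_lt]
  rw [volume_shrink_image, ← mul_assoc] at hle
  by_contra hne
  refine hle.not_gt ?_
  calc _ < 1 * volume wandering := ENNReal.mul_lt_mul_left hne hfin hlt
    _ = volume wandering := one_mul _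

/-! ### Outer billiards and similarities -/

theorem cross_mul (u a b : ℂ) : cross (u * a) (u * b) = Complex.normSq u * cross a b := by
  simp only [cross, Complex.mul_re, Complex.mul_im, Complex.normSq_apply]
  ring

section

variable {γ : Set ℂ} {p p' v v' : ℂ}

theorem IsRightTangencyPoint.two_mul_sub_notMem (h : IsRightTangencyPoint γ p v) (hp : p ∉ γ) :
    2 * v - p ∉ γ := by
  intro hmem
  have hne : 2 * v - p ≠ v := fun heq => hp (by
    rw [show p = v by linear_combination -heq]
    exact h.1)
  have hpos := h.2 _ hmem hne
  simp only [cross, Complex.sub_re, Complex.sub_im, Complex.mul_re, Complex.mul_im,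
    Complex.re_ofNat, Complex.im_ofNat] at hpos
  linarith

theorem IsRightTangencyPoint.eq_of_two_mul_sub_eq (h : IsRightTangencyPoint γ p v)
    (h' : IsRightTangencyPoint γ p' v') (heq : 2 * v - p = 2 * v' - p') : p = p' := by
  by_cases hv : v = v'
  · subst hv
    exact sub_right_injective heq
  have hpos := h.2 v' h'.1 (Ne.symm hv)
  have hpos' := h'.2 v h.1 hv
  obtain rfl : p' = 2 * v' - 2 * v + p := by linear_combination heq
  simp only [cross, Complex.sub_re, Complex.sub_im, Complex.add_re, Complex.add_im, Complex.mul_re,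
    Complex.mul_im, Complex.re_ofNat, Complex.im_ofNat] at hpos hpos'
  linarith

theorem IsRightTangencyPoint.image {u : ℂ} (hu : u ≠ 0) (c : ℂ) (h : IsRightTangencyPoint γ p v) :
    IsRightTangencyPoint ((fun z => u * z + c) '' γ) (u * p + c) (u * v + c) := by
  refine ⟨⟨v, h.1, rfl⟩, ?_⟩
  rintro _ ⟨w, hw, rfl⟩ hne
  have hpos := h.2 w hw fun heq => hne (by rw [heq])
  simp only [add_sub_add_right_eq_sub, ← mul_sub, cross_mul]
  exact mul_pos (Complex.normSq_pos.2 hu) hpos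

theorem outerBilliard_dom_image {u : ℂ} (hu : u ≠ 0) (c : ℂ) (h : (outerBilliard γ p).Dom) :
    (outerBilliard ((fun z => u * z + c) '' γ) (u * p + c)).Dom := by
  obtain ⟨hp, v, hv⟩ := h
  refine ⟨?_, _, hv.image hu c⟩
  rintro ⟨q, hq, heq⟩
  rw [mul_left_cancel₀ hu (add_right_cancel heq)] at hq
  exact hp hq

open Classical in
/-- The outer billiard map with table `γ`, extended by the identity to the points where it is
undefined. -/
noncomputable def step (γ : Set ℂ) (p : ℂ) : ℂ := (outerBilliard γ p).getOrElse p

theorem step_mem_outerBilliard (h : (outerBilliard γ p).Dom) : step γ p ∈ outerBilliard γ p := by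
  classical
  rw [step, Part.getOrElse_of_dom _ h]
  exact Part.get_mem h

theorem step_eq_self (h : ¬(outerBilliard γ p).Dom) : step γ p = p := by
  classical exact Part.getOrElse_of_not_dom _ h p

theorem step_eq (hp : p ∉ γ) (hv : IsRightTangencyPoint γ p v) : step γ p = 2 * v - p :=
  Part.mem_unique (step_mem_outerBilliard ⟨hp, v, hv⟩) (mem_outerBilliard.2 ⟨hp, v, hv, rfl⟩)

theorem step_injOn : Set.InjOn (step γ) {p | (outerBilliard γ p).Dom} := by
  rintro p ⟨hp, v, hv⟩ p' ⟨hp', v', hv'⟩ heq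
  rw [step_eq hp hv, step_eq hp' hv'] at heq
  exact hv.eq_of_two_mul_sub_eq hv' heq

theorem step_semiconj_image {u : ℂ} (hu : u ≠ 0) (c : ℂ) :
    Semiconj (fun z => u * z + c) (step γ) (step ((fun z => u * z + c) '' γ)) := by
  intro p
  by_cases h : (outerBilliard γ p).Dom
  · obtain ⟨hp, v, hv⟩ := h
    rw [step_eq hp hv, step_eq (outerBilliard_dom_image hu c ⟨hp, v, hv⟩).1 (hv.image hu c)]
    ring
  · rw [step_eq_self h, step_eq_self fun himage => h ?_]
    have hpre := outerBilliard_dom_image (inv_ne_zero hu) (-(u⁻¹ * c)) himage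
    have hinv : ∀ z, u⁻¹ * (u * z + c) + -(u⁻¹ * c) = z := fun z => by field_simp; ring
    simpa only [Set.image_image, hinv, Set.image_id'] using hpre

theorem mem_iter_outerBilliard_iff {n : ℕ} {q : ℂ} : q ∈ iter (outerBilliard γ) n p ↔
    (∀ i < n, (outerBilliard γ ((step γ)^[i] p)).Dom) ∧ (step γ)^[n] p = q := by
  induction n generalizing q with
  | zero => simp [iter, eq_comm]
  | succ n ih =>
    rw [iter, Part.mem_bind_iff]
    constructor
    · rintro ⟨r, hr, hq⟩
      obtain ⟨hdom, rfl⟩ := ih.1 hr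
      have hdom' := Part.dom_iff_mem.2 ⟨q, hq⟩
      refine ⟨fun i hi => ?_, ?_⟩
      · rcases Nat.lt_succ_iff_lt_or_eq.1 hi with hi | rfl
        exacts [hdom i hi, hdom']
      · rw [iterate_succ_apply']
        exact Part.mem_unique (step_mem_outerBilliard hdom') hq
    · rintro ⟨hdom, rfl⟩
      refine ⟨_, ih.2 ⟨fun i hi => hdom i (hi.trans n.lt_succ_self), rfl⟩, ?_⟩
      rw [iterate_succ_apply']
      exact step_mem_outerBilliard (hdom n n.lt_succ_self)

theorem isPeriodic_iff :
    IsPeriodic γ p ↔ (outerBilliard γ p).Dom ∧ p ∈ periodicPts (step γ) := by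
  constructor
  · rintro ⟨n, hn, h⟩
    obtain ⟨hdom, heq⟩ := mem_iter_outerBilliard_iff.1 h
    exact ⟨hdom 0 hn, n, hn, heq⟩
  · rintro ⟨hdom, n, hn, hper⟩
    refine ⟨n, hn, mem_iter_outerBilliard_iff.2 ⟨fun i _ => ?_, hper⟩⟩
    by_contra hi
    -- the orbit would end at the fixed point reached after `i` steps, and hence start there
    have hfix : (step γ)^[n * i - i] ((step γ)^[i] p) = (step γ)^[i] p :=
      IsFixedPt.iterate (step_eq_self hi) _
    rw [← iterate_add_apply, Nat.sub_add_cancel (Nat.le_mul_of_pos_left i hn),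
      (hper.mul_const i).eq] at hfix
    exact hi (hfix ▸ hdom)

theorem isPeriodic_of_isPreperiodic
    (hdom : ∀ n, (outerBilliard γ ((step γ)^[n] p)).Dom) (h : IsPreperiodic (step γ) p) :
    IsPeriodic γ p := by
  refine isPeriodic_iff.2 ⟨hdom 0, ?_⟩
  obtain ⟨n, k, hk, hper⟩ := h
  refine ⟨k, hk, ?_⟩
  rw [IsPeriodicPt, IsFixedPt, ← iterate_add_apply, add_comm] at hper
  induction n with
  | zero => rwa [zero_add] at hper
  | succ n ih =>
    rw [Nat.succ_add, iterate_succ_apply', iterate_succ_apply'] at hper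
    exact ih (step_injOn (hdom _) (hdom _) hper)

theorem IsPeriodic.image {u : ℂ} (hu : u ≠ 0) (c : ℂ) (h : IsPeriodic γ p) :
    IsPeriodic ((fun z => u * z + c) '' γ) (u * p + c) := by
  obtain ⟨hdom, hper⟩ := isPeriodic_iff.1 h
  exact isPeriodic_iff.2
    ⟨outerBilliard_dom_image hu c hdom, (step_semiconj_image hu c).mapsTo_periodicPts hper⟩

theorem ae_isPeriodic_image {u : ℂ} (hu : u ≠ 0) (c : ℂ) (h : ∀ᵐ p, p ∉ γ → IsPeriodic γ p) :
    ∀ᵐ p, p ∉ (fun z => u * z + c) '' γ → IsPeriodic ((fun z => u * z + c) '' γ) p := by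
  have hnull := addHaar_image_eq_zero_of_differentiableOn_of_addHaar_eq_zero volume
    ((differentiable_id.const_mul u).add_const c).differentiableOn h
  refine measure_mono_null (fun q hq => ?_) hnull
  have hinv : u * (u⁻¹ * (q - c)) + c = q := by field_simp; ring
  refine ⟨u⁻¹ * (q - c), fun hp => hq fun hqγ => ?_, hinv⟩
  simpa only [hinv] using (hp fun hmem => hqγ ⟨_, hmem, hinv⟩).image hu c

end

/-! ### The dodecagon of inradius one -/

/-- The regular dodecagon with center `0` and inradius `1`. -/
def table : Set ℂ := {z | ∀ k, ht k z ≤ 1}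

/-- The vertex of the dodecagon `table` in which its sides on the lines `ht 2 = 1` and `ht 3 = 1`
meet. -/
noncomputable def vert : ℂ := toComplex ⟨⟨2, -2⟩, 2⟩

theorem isAlgebraic_vert : IsAlgebraic ℚ vert := isAlgebraic_toComplex _

theorem ht_two_vert : ht 2 vert = 1 := by
  have h := ht_toComplex_of_twiceHt_eq (k := 2) (x := ⟨⟨2, -2⟩, 2⟩) (y := 2) (by decide +kernel)
  rw [vert, h, map_ofNat, div_self two_ne_zero]

theorem ht_three_vert : ht 3 vert = 1 := by
  have h := ht_toComplex_of_twiceHt_eq (k := 3) (x := ⟨⟨2, -2⟩, 2⟩) (y := 2) (by decide +kernel)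
  rw [vert, h, map_ofNat, div_self two_ne_zero]

theorem zeta_neg_two_mul_vert : ζ (-2) * vert = ⟨1, 2 - √3⟩ := by
  have h := ht_toComplex_of_twiceHt_eq (k := 5) (x := ⟨⟨2, -2⟩, 2⟩) (y := ⟨4, -2⟩)
    (by decide +kernel)
  apply Complex.ext
  · rw [← ht_zero, ht_zeta_mul, sub_neg_eq_add, zero_add, ht_two_vert]
  · rw [← ht_three, ht_zeta_mul, show (3 - -2 : ZMod 12) = 5 from rfl, vert, h, toReal_apply]
    push_cast
    ring

theorem zeta_neg_three_mul_vert : ζ (-3) * vert = ⟨1, √3 - 2⟩ := by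
  have h := ht_toComplex_of_twiceHt_eq (k := 6) (x := ⟨⟨2, -2⟩, 2⟩) (y := ⟨-4, 2⟩)
    (by decide +kernel)
  apply Complex.ext
  · rw [← ht_zero, ht_zeta_mul, sub_neg_eq_add, zero_add, ht_three_vert]
  · rw [← ht_three, ht_zeta_mul, show (3 - -3 : ZMod 12) = 6 from rfl, vert, h, toReal_apply]
    push_cast
    ring

theorem vert_ne_zero : vert ≠ 0 := fun h => by
  have h₂ := ht_two_vert
  rw [h, map_zero] at h₂
  exact zero_ne_one h₂

theorem zeta_one_mul_two_sub_vert : ζ 1 * (2 - vert) = 2 := by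
  have h : rot (2 - ⟨⟨2, -2⟩, 2⟩) = 2 := by decide +kernel
  rw [vert, ← map_ofNat toComplex 2, ← map_sub, ← toComplex_rot, h]

theorem vert_mem_table : vert ∈ table := fun k => by
  have hle : ∀ k, twiceHt k ⟨⟨2, -2⟩, 2⟩ ≤ 2 := by decide +kernel
  have h := toReal_mono (hle k)
  rw [toReal_twiceHt, map_ofNat] at h
  rw [vert]
  linarith

theorem zeta_mul_mem_table {z : ℂ} (hz : z ∈ table) (s : ZMod 12) : ζ s * z ∈ table := fun k => by
  rw [ht_zeta_mul]
  exact hz _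

theorem image_zeta_mul_table (s : ZMod 12) : (fun z => ζ s * z + 0) '' table = table := by
  refine Set.Subset.antisymm ?_ fun z hz => ⟨ζ (-s) * z, zeta_mul_mem_table hz _, ?_⟩
  · rintro _ ⟨z, hz, rfl⟩
    beta_reduce
    rw [add_zero]
    exact zeta_mul_mem_table hz s
  · simpa using zeta_neg_mul_zeta_mul (-s) z

theorem convex_table : Convex ℝ table := by
  rw [table, Set.ofPred_forall]
  exact convex_iInter fun k => convex_halfSpace_le (ht k).isLinear 1

theorem exists_eq_combination_of_ht_le {w : ℂ} (h : ht 0 w ≤ 1) (h₁ : ht 1 w ≤ ht 0 w)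
    (h₁₁ : ht (-1) w ≤ ht 0 w) : ∃ a b : ℝ, 0 ≤ a ∧ 0 ≤ b ∧ a + b ≤ 1 ∧
      w = a * (ζ (-2) * vert) + b * (ζ (-3) * vert) := by
  have hsq := sq_sqrt_three
  have e₁ : ht 1 w = (√3 * w.re + w.im) / 2 := by
    rw [ht_apply, ← conj_zeta, zeta_one, Complex.mul_re, Complex.conj_re, Complex.conj_im]
    ring
  have e₁₁ : ht (-1) w = (√3 * w.re - w.im) / 2 := by
    rw [ht_apply, neg_neg, zeta_one, Complex.mul_re]
    ring
  rw [ht_zero] at h h₁ h₁₁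
  rw [e₁] at h₁
  rw [e₁₁] at h₁₁
  have hle : 0 ≤ (2 + √3) * ((2 - √3) * w.re - w.im) := mul_nonneg (by positivity) (by linarith)
  have hge : 0 ≤ (2 + √3) * ((2 - √3) * w.re + w.im) := mul_nonneg (by positivity) (by linarith)
  have hinv : (2 + √3) * (2 - √3) = 1 := by linarith
  rw [mul_sub, ← mul_assoc, hinv] at hle
  rw [mul_add, ← mul_assoc, hinv] at hge
  refine ⟨(w.re + (2 + √3) * w.im) / 2, (w.re - (2 + √3) * w.im) / 2, by linarith, by linarith,
    by linarith, ?_⟩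
  rw [zeta_neg_two_mul_vert, zeta_neg_three_mul_vert]
  apply Complex.ext
  · simp only [Complex.add_re, Complex.re_ofReal_mul]
    ring
  · simp only [Complex.add_im, Complex.im_ofReal_mul]
    linear_combination -w.im * hinv

theorem table_eq_convexHull : table = convexHull ℝ (Set.range fun k => ζ k * vert) := by
  set hull := convexHull ℝ (Set.range fun k => ζ k * vert)
  have hvert (k : ZMod 12) : ζ k * vert ∈ hull := subset_convexHull _ _ ⟨k, rfl⟩
  have hconvex : Convex ℝ hull := convex_convexHull _ _
  have hzero : (0 : ℂ) ∈ hull := by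
    have h := hconvex.midpoint_mem (hvert 0) (hvert 6)
    rwa [zeta_six, AddChar.map_zero_eq_one, one_mul, neg_one_mul, midpoint_self_neg] at h
  refine Set.Subset.antisymm (fun z hz => ?_) (convexHull_min ?_ convex_table)
  · obtain ⟨k, hk⟩ := Finite.exists_max fun k => ht k z
    have hht (j : ZMod 12) : ht j (ζ (-k) * z) = ht (j + k) z := by rw [ht_zeta_mul, sub_neg_eq_add]
    obtain ⟨a, b, ha, hb, hab, hw⟩ := exists_eq_combination_of_ht_le (w := ζ (-k) * z)
      (by rw [hht]; exact hz _) (by rw [hht, hht, zero_add]; exact hk _)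
      (by rw [hht, hht, zero_add]; exact hk _)
    have hz : z = a • (ζ (k - 2) * vert) + b • (ζ (k - 3) * vert) := by
      have h := zeta_neg_mul_zeta_mul (-k) z
      rw [neg_neg, hw] at h
      rw [← h, sub_eq_add_neg, sub_eq_add_neg, AddChar.map_add_eq_mul, AddChar.map_add_eq_mul,
        Complex.real_smul, Complex.real_smul]
      ring
    have hsum := hconvex.sum_mem (t := Finset.univ) (w := ![a, b, 1 - a - b])
      (z := ![ζ (k - 2) * vert, ζ (k - 3) * vert, 0])
      (by intro i _; fin_cases i; exacts [ha, hb, sub_nonneg.2 (le_sub_left_of_add_le hab)])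
      (by simp [Fin.sum_univ_three])
      (by intro i _; fin_cases i; exacts [hvert _, hvert _, hzero])
    simpa [hz, Fin.sum_univ_three] using hsum
  · rintro _ ⟨k, rfl⟩
    exact zeta_mul_mem_table vert_mem_table k

theorem regularDodecagon_eq_image (c a : ℂ) :
    regularDodecagon c a = (fun z => a / vert * z + c) '' table := by
  have h : (fun z => a / vert * z + c) =
      ((LinearMap.mulLeft ℝ (a / vert)).toAffineMap + AffineMap.const ℝ ℂ c : ℂ →ᵃ[ℝ] ℂ) := by
    ext z
    simp
  rw [table_eq_convexHull, h, AffineMap.image_convexHull, ← Set.range_comp, ← h, regularDodecagon]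
  refine congrArg (convexHull ℝ) (congrArg Set.range (funext fun k : ZMod 12 => ?_))
  have hk : Complex.exp (2 * Real.pi * Complex.I * k.val / 12) = ζ k := by
    rw [← zeta_natCast, ZMod.natCast_zmod_val]
  have hv := vert_ne_zero
  change c + a * Complex.exp (2 * Real.pi * Complex.I * k.val / 12) = a / vert * (ζ k * vert) + c
  rw [hk]
  field_simp
  ring

theorem two_mul_ht_two (z : ℂ) : 2 * ht 2 z = z.re + √3 * z.im := by
  obtain ⟨-, h, -⟩ := ht_eq_of_ht_neg_three_of_ht_two z
  have h₃ : ht 3 z = -ht (-3) z := ht_add_six (-3) z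
  rw [← ht_zero, ← ht_three, h, h₃]
  ring

theorem cross_eq_two_mul (a b : ℂ) :
    cross a b = 2 * (ht 2 a * ht 3 b - ht 3 a * ht 2 b) := by
  rw [cross, ht_three, ht_three]
  linear_combination -b.im * two_mul_ht_two a + a.im * two_mul_ht_two b

/-- The region from which the right tangent to the dodecagon `table` goes through `vert`. -/
def Wedge : Set ℂ := {p | ht 3 p < 1 ∧ 1 < ht 2 p}

theorem isRightTangencyPoint_of_mem_wedge {p : ℂ} (hp : p ∈ Wedge) :
    IsRightTangencyPoint table p vert := by
  refine ⟨vert_mem_table, fun w hw hne => ?_⟩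
  have h₂ := hw 2
  have h₃ := hw 3
  have hpos₂ : 0 < ht 2 p - 1 := sub_pos.2 hp.2
  have hpos₃ : 0 < 1 - ht 3 p := sub_pos.2 hp.1
  have hcross : cross (vert - p) (w - p) =
      2 * ((ht 2 p - 1) * (1 - ht 3 w) + (1 - ht 3 p) * (1 - ht 2 w)) := by
    simp only [cross_eq_two_mul, map_sub, ht_two_vert, ht_three_vert]
    ring
  rw [hcross]
  by_contra! hle
  have hnonneg₂ := mul_nonneg hpos₂.le (sub_nonneg.2 h₃)
  have hnonneg₃ := mul_nonneg hpos₃.le (sub_nonneg.2 h₂)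
  have e₃ : ht 3 w = ht 3 vert := by
    have h := (mul_eq_zero.1 (le_antisymm (by linarith) hnonneg₂)).resolve_left hpos₂.ne'
    rw [ht_three_vert]
    linarith
  have e₂ : ht 2 w = ht 2 vert := by
    have h := (mul_eq_zero.1 (le_antisymm (by linarith) hnonneg₃)).resolve_left hpos₃.ne'
    rw [ht_two_vert]
    linarith
  have him : w.im = vert.im := by rw [← ht_three, ← ht_three, e₃]
  have hre := two_mul_ht_two w
  rw [e₂, two_mul_ht_two, him, add_left_inj] at hre
  exact hne (Complex.ext hre.symm him)

theorem notMem_table_of_mem_wedge {p : ℂ} (hp : p ∈ Wedge) : p ∉ table :=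
  fun h => (h 2).not_gt hp.2

theorem step_eq_of_mem_wedge {p : ℂ} (hp : p ∈ Wedge) : step table p = 2 * vert - p :=
  step_eq (notMem_table_of_mem_wedge hp) (isRightTangencyPoint_of_mem_wedge hp)

theorem exists_zeta_mul_mem_wedge {p : ℂ} (hgen : Generic p) (hp : p ∉ table) :
    ∃ s, ζ s * p ∈ Wedge := by
  suffices ∃ k, 1 < ht k p ∧ ht (k + 1) p ≤ 1 by
    obtain ⟨k, hk, hk'⟩ := this
    refine ⟨2 - k, ?_, ?_⟩
    · rw [ht_zeta_mul, show 3 - (2 - k) = k + 1 by ring]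
      exact hk'.lt_of_ne (hgen.ht_ne _ isAlgebraic_one)
    · rwa [ht_zeta_mul, sub_sub_cancel]
  by_contra! hsucc
  obtain ⟨k, hk⟩ : ∃ k, 1 < ht k p := by
    by_contra! hle
    exact hp hle
  have hall (i : ℕ) : 1 < ht (k + i) p := by
    induction i with
    | zero => simpa using hk
    | succ i ih =>
      rw [Nat.cast_succ, ← add_assoc]
      exact hsucc _ ih
  have h₆ := hall 6
  rw [Nat.cast_ofNat, ht_add_six] at h₆
  linarith

theorem commute_step_table (s : ZMod 12) : Function.Commute (fun z => ζ s * z) (step table) := by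
  have h := step_semiconj_image (γ := table) (zeta_ne_zero s) 0
  rw [image_zeta_mul_table] at h
  simp only [add_zero] at h
  exact h

theorem step_table_iterate_zeta_mul (s : ZMod 12) (n : ℕ) (p : ℂ) :
    (step table)^[n] (ζ s * p) = ζ s * (step table)^[n] p :=
  (((commute_step_table s).iterate_right n).eq p).symm

theorem isPreperiodic_zeta_mul_iff {s : ZMod 12} {p : ℂ} :
    IsPreperiodic (step table) (ζ s * p) ↔ IsPreperiodic (step table) p := by
  refine ⟨fun h => ?_, fun h => h.map (commute_step_table s)⟩
  simpa only [zeta_neg_mul_zeta_mul] using h.map (commute_step_table (-s))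

theorem isPreperiodic_of_finite_of_forall_return {S : Set ℂ} (hS : S.Finite)
    (h : ∀ p ∈ S, ∃ n, 0 < n ∧ ∃ s, ∃ q ∈ S, (step table)^[n] p = ζ s * q) {p : ℂ} (hp : p ∈ S) :
    IsPreperiodic (step table) p := by
  refine .of_finite_of_forall_return (S := ⋃ s, (fun q => ζ s * q) '' S)
    (Set.finite_iUnion fun s => hS.image _) ?_ (Set.mem_iUnion.2 ⟨0, p, hp, by simp⟩)
  intro p hp
  obtain ⟨s, q, hq, rfl⟩ := Set.mem_iUnion.1 hp
  obtain ⟨n, hn, t, r, hr, heq⟩ := h q hq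
  refine Or.inr ⟨n, hn, Set.mem_iUnion.2 ⟨s + t, r, hr, ?_⟩⟩
  beta_reduce
  rw [step_table_iterate_zeta_mul, heq, AddChar.map_add_eq_mul, mul_assoc]

theorem outerBilliard_table_dom {p : ℂ} (hgen : Generic p) (hp : p ∉ table) :
    (outerBilliard table p).Dom := by
  obtain ⟨s, hs⟩ := exists_zeta_mul_mem_wedge hgen hp
  have h : (outerBilliard table (ζ s * p)).Dom :=
    ⟨notMem_table_of_mem_wedge hs, vert, isRightTangencyPoint_of_mem_wedge hs⟩
  have hback := outerBilliard_dom_image (zeta_ne_zero (-s)) 0 h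
  rwa [image_zeta_mul_table, add_zero, zeta_neg_mul_zeta_mul] at hback

theorem Generic.step_table {p : ℂ} (hgen : Generic p) (hp : p ∉ table) :
    Generic (step table p) := by
  obtain ⟨s, hs⟩ := exists_zeta_mul_mem_wedge hgen hp
  have hconj : step table p = ζ (-s) * (2 * vert - ζ s * p) := by
    rw [← step_eq_of_mem_wedge hs, ← (commute_step_table s).eq, zeta_neg_mul_zeta_mul]
  rw [hconj, two_mul]
  exact ((hgen.zeta_mul s).const_sub (isAlgebraic_vert.add isAlgebraic_vert)).zeta_mul (-s)

theorem outerBilliard_table_dom_iterate {p : ℂ} (hgen : Generic p) (hp : p ∉ table) (n : ℕ) :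
    (outerBilliard table ((step table)^[n] p)).Dom := by
  suffices Generic ((step table)^[n] p) ∧ (step table)^[n] p ∉ table from
    outerBilliard_table_dom this.1 this.2
  induction n with
  | zero => exact ⟨hgen, hp⟩
  | succ n ih =>
    rw [iterate_succ_apply']
    obtain ⟨hmem, v, hv⟩ := outerBilliard_table_dom ih.1 ih.2
    refine ⟨ih.1.step_table ih.2, ?_⟩
    rw [step_eq hmem hv]
    exact hv.two_mul_sub_notMem hmem

theorem ht_sub_nsmul_vert (p : ℂ) (m : ℕ) :
    ht 2 (p - m • vert) = ht 2 p - m ∧ ht 3 (p - m • vert) = ht 3 p - m := by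
  simp only [map_sub, map_nsmul, ht_two_vert, ht_three_vert, nsmul_one, and_self]

theorem exists_step_iterate_eq_zeta_mul_sub (m : ℕ) {p : ℂ} (h₃ : ht 3 p < 1)
    (h₂ : 2 * m - 1 < ht 2 p) : ∃ s, (step table)^[m] p = ζ s * (p - (2 * m) • vert) := by
  induction m with
  | zero => exact ⟨0, by simp⟩
  | succ m ih =>
    push_cast at h₂
    obtain ⟨s, hs⟩ := ih (by linarith)
    obtain ⟨e₂, e₃⟩ := ht_sub_nsmul_vert p (2 * m)
    push_cast at e₂ e₃
    have hw : p - (2 * m) • vert ∈ Wedge :=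
      ⟨by linarith [m.cast_nonneg (α := ℝ)], by linarith⟩
    refine ⟨s + 6, ?_⟩
    rw [iterate_succ_apply', hs, ← (commute_step_table s).eq, step_eq_of_mem_wedge hw,
      AddChar.map_add_eq_mul, zeta_six]
    simp only [nsmul_eq_mul]
    push_cast
    ring

/-! ### Cells of the half-strip -/

theorem ht_four_mul_add (n : ℕ) (z : ℂ) :
    ht 2 (4 * n + z) = 2 * n + ht 2 z ∧ ht 3 (4 * n + z) = ht 3 z := by
  have e₂ := ht_toComplex_of_twiceHt_eq (k := 2) (x := 4) (y := 4) (by decide +kernel)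
  have e₃ := ht_toComplex_of_twiceHt_eq (k := 3) (x := 4) (y := 0) (by decide +kernel)
  simp only [map_zero, map_ofNat] at e₂ e₃
  rw [mul_comm, ← nsmul_eq_mul, map_add, map_add, map_nsmul, map_nsmul, e₂, e₃, nsmul_eq_mul,
    nsmul_eq_mul]
  constructor <;> ring

theorem isAlgebraic_four_mul (n : ℕ) : IsAlgebraic ℚ (4 * n : ℂ) := by
  rw [← Nat.cast_ofNat, ← Nat.cast_mul]
  exact isAlgebraic_natCast _

/-- Up to rotations, an iterate of the outer billiard map rotates the `n`-th cell of the strip about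
its center `4 * n`. -/
theorem exists_step_iterate_eq_zeta_mul_add (n : ℕ) {x : ℂ} (h₂ : -1 < ht 2 x) (h₃ : ht 3 x < 1) :
    ∃ s, (step table)^[n] (4 * n + x) = ζ s * (4 * n + ζ 1 * x) := by
  obtain ⟨e₂, e₃⟩ := ht_four_mul_add n x
  obtain ⟨s, hs⟩ := exists_step_iterate_eq_zeta_mul_sub n (p := 4 * n + x) (by rwa [e₃])
    (by linarith)
  refine ⟨s + -1, ?_⟩
  have hcenter : 4 * n + ζ 1 * x = ζ 1 * (4 * n + x - (2 * n) • vert) := by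
    rw [nsmul_eq_mul]
    push_cast
    linear_combination -2 * n * zeta_one_mul_two_sub_vert
  rw [hs, hcenter, AddChar.map_add_eq_mul, mul_assoc, zeta_neg_mul_zeta_mul]

/-- The two points of the strip which the point `x` of the horn stands for: the one in the horn of
the `n`-th cell, and the one in the opposite horn of the next cell. -/
def stripPair (n : ℕ) (x : ℂ) : Set ℂ := {4 * n + x, 4 * (n + 1 : ℕ) - x}

theorem four_mul_add_zeta_one_mul_mem_stripPair (n : ℕ) (x : ℂ) :
    4 * n + ζ 1 * x ∈ stripPair n (hornMap x) := by
  unfold hornMap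
  split_ifs
  · exact Or.inl rfl
  · refine Or.inr (Set.mem_singleton_iff.2 ?_)
    push_cast
    ring

theorem four_mul_succ_add_zeta_one_mul_neg_mem_stripPair (n : ℕ) (x : ℂ) :
    4 * (n + 1 : ℕ) + ζ 1 * -x ∈ stripPair n (hornMap x) := by
  unfold hornMap
  split_ifs
  · exact Or.inr (Set.mem_singleton_iff.2 (by ring))
  · refine Or.inl ?_
    push_cast
    ring

theorem exists_step_iterate_four_mul_add {x : ℂ} (hx : x ∈ Horn) (n : ℕ) :
    ∃ s, ∃ w ∈ stripPair n (hornMap x), (step table)^[n] (4 * n + x) = ζ s * w := by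
  obtain ⟨h₉, h₂, -⟩ := Horn.neg_one_lt_ht hx
  have e₃ : ht 3 x = -ht (-3) x := ht_add_six (-3) x
  obtain ⟨s, hs⟩ := exists_step_iterate_eq_zeta_mul_add n h₂ (by linarith)
  exact ⟨s, _, four_mul_add_zeta_one_mul_mem_stripPair n x, hs⟩

theorem exists_step_iterate_four_mul_succ_sub {x : ℂ} (hx : x ∈ Horn) (n : ℕ) :
    ∃ s, ∃ w ∈ stripPair n (hornMap x),
      (step table)^[n + 1] (4 * (n + 1 : ℕ) - x) = ζ s * w := by
  have e₃ : ht 3 x = -ht (-3) x := ht_add_six (-3) x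
  obtain ⟨s, hs⟩ := exists_step_iterate_eq_zeta_mul_add (n + 1) (x := -x)
    (by rw [map_neg]; linarith [hx.2.1]) (by rw [map_neg]; linarith [hx.1])
  rw [← sub_eq_add_neg] at hs
  exact ⟨s, _, four_mul_succ_add_zeta_one_mul_neg_mem_stripPair n x, hs⟩

theorem Horn.exists_eq_zeta_mul_four_sub {x : ℂ} (hx : x ∈ Horn) :
    ∃ s, ∃ j, x = ζ s * (4 - hornMap^[j] x) := by
  obtain ⟨j, -, hj, hle⟩ := exists_hornMap_iterate_eq_zeta_mul hx
  refine ⟨-(1 + j), j + 1, ?_⟩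
  rw [iterate_succ_apply', hornMap, if_neg hle.not_gt, sub_sub_cancel, hj, ← mul_assoc (ζ 1),
    ← AddChar.map_add_eq_mul, zeta_neg_mul_zeta_mul]

theorem exists_step_iterate_mem_stripPair {x z : ℂ} {n : ℕ} (hx : x ∈ Horn) (hgen : Generic x)
    (hz : z ∈ stripPair n x) : ∃ k, 0 < k ∧ ∃ s, ∃ j, ∃ w ∈ stripPair n (hornMap^[j] x),
      (step table)^[k] z = ζ s * w := by
  rcases hz with rfl | rfl
  · rcases n.eq_zero_or_pos with rfl | hn
    · obtain ⟨s, j, hj⟩ := Horn.exists_eq_zeta_mul_four_sub hx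
      obtain ⟨t, w, hw, hwz⟩ :=
        exists_step_iterate_four_mul_succ_sub (hornMap_iterate_mem_horn hx hgen j) 0
      rw [← iterate_succ_apply' hornMap] at hw
      refine ⟨1, one_pos, s + t, j + 1, w, hw, ?_⟩
      rw [zero_add, Nat.cast_one, mul_one] at hwz
      rw [Nat.cast_zero, mul_zero, zero_add, AddChar.map_add_eq_mul, mul_assoc, ← hwz,
        ← step_table_iterate_zeta_mul, ← hj]
    · obtain ⟨s, w, hw, hwz⟩ := exists_step_iterate_four_mul_add hx n
      exact ⟨n, hn, s, 1, w, hw, hwz⟩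
  · obtain ⟨s, w, hw, hwz⟩ := exists_step_iterate_four_mul_succ_sub hx n
    exact ⟨n + 1, n.succ_pos, s, 1, w, hw, hwz⟩

theorem isPreperiodic_of_mem_stripPair {x z : ℂ} {n : ℕ} (hx : x ∈ Horn) (hgen : Generic x)
    (h : IsPreperiodic hornMap x) (hz : z ∈ stripPair n x) : IsPreperiodic (step table) z := by
  refine isPreperiodic_of_finite_of_forall_return
    (S := ⋃ y ∈ Set.range fun i => hornMap^[i] x, stripPair n y)
    (h.finite_range.biUnion fun y _ => Set.toFinite {_, _}) ?_
    (Set.mem_biUnion ⟨0, rfl⟩ hz)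
  intro p hp
  simp only [Set.mem_iUnion] at hp
  obtain ⟨_, ⟨i, rfl⟩, hp⟩ := hp
  obtain ⟨k, hk, s, j, w, hw, hwp⟩ := exists_step_iterate_mem_stripPair
    (hornMap_iterate_mem_horn hx hgen i) (hgen.hornMap_iterate i) hp
  rw [← iterate_add_apply] at hw
  exact ⟨k, hk, s, w, Set.mem_biUnion ⟨j + i, rfl⟩ hw, hwp⟩

theorem isPreperiodic_four_mul_add_of_mem_table {n : ℕ} (hn : 0 < n) {x : ℂ} (hx : x ∈ table)
    (hgen : Generic x) : IsPreperiodic (step table) (4 * n + x) := by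
  have hlt (k s : ZMod 12) : ht k (ζ s * x) < 1 :=
    (zeta_mul_mem_table hx s k).lt_of_ne ((hgen.zeta_mul s).ht_ne k isAlgebraic_one)
  refine isPreperiodic_of_finite_of_forall_return (S := Set.range fun s => 4 * n + ζ s * x)
    (Set.finite_range _) ?_ ⟨0, by simp⟩
  rintro _ ⟨s, rfl⟩
  have h₈ : ht 8 (ζ s * x) = -ht 2 (ζ s * x) := ht_add_six 2 _
  obtain ⟨t, htx⟩ := exists_step_iterate_eq_zeta_mul_add n (x := ζ s * x)
    (by linarith [hlt 8 s]) (hlt 3 s)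
  rw [← mul_assoc, ← AddChar.map_add_eq_mul] at htx
  exact ⟨n, hn, t, _, ⟨1 + s, rfl⟩, htx⟩

theorem exists_int_abs_sub_two_mul_lt {r : ℝ} (hr : Transcendental ℚ r) :
    ∃ m : ℤ, -1 < r - 2 * m ∧ r - 2 * m < 1 := by
  refine ⟨⌊(r + 1) / 2⌋, ?_, by linarith [Int.lt_floor_add_one ((r + 1) / 2)]⟩
  refine lt_of_le_of_ne (by linarith [Int.floor_le ((r + 1) / 2)]) fun heq => hr ?_
  have hr_eq : r = ((2 * ⌊(r + 1) / 2⌋ - 1 : ℤ) : ℝ) := by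
    push_cast
    linarith
  rw [hr_eq]
  exact isAlgebraic_intCast _

theorem mem_horn_or_neg_mem_horn {x : ℂ} (hx : x ∉ table) (h₂ : -1 < ht 2 x) (h₂' : ht 2 x < 1)
    (h₃ : -1 < ht 3 x) (h₃' : ht 3 x < 1) : x ∈ Horn ∨ -x ∈ Horn := by
  obtain ⟨k, hk⟩ : ∃ k, 1 < ht k x := by
    by_contra! hle
    exact hx hle
  have e₉ : ht (-3) x = -ht 3 x := ht_add_six 3 x
  have e₈ : ht 8 x = -ht 2 x := ht_add_six 2 x
  have hpos (j : ℕ) (hj : j ≤ 3) (h : 1 < ht (1 - j) x) : x ∈ Horn :=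
    ⟨by linarith, h₂', j, hj, h⟩
  have hneg (j : ℕ) (hj : j ≤ 3) (h : 1 < ht (1 - j + 6) x) : -x ∈ Horn := by
    refine ⟨by rw [map_neg]; linarith, by rw [map_neg]; linarith, j, hj, ?_⟩
    rwa [map_neg, ← ht_add_six]
  fin_cases k
  · exact Or.inl (hpos 1 (by norm_num) hk)
  · exact Or.inl (hpos 0 (by norm_num) hk)
  · exact absurd hk h₂'.not_gt
  · exact absurd hk h₃'.not_gt
  · exact Or.inr (hneg 3 (by norm_num) hk)
  · exact Or.inr (hneg 2 (by norm_num) hk)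
  · exact Or.inr (hneg 1 (by norm_num) hk)
  · exact Or.inr (hneg 0 (by norm_num) hk)
  · exact absurd (e₈ ▸ hk) (by linarith)
  · exact absurd (e₉ ▸ hk) (by linarith)
  · exact Or.inl (hpos 3 (by norm_num) hk)
  · exact Or.inl (hpos 2 (by norm_num) hk)

/-- The half-strip on the right of the dodecagon `table`, between the extensions of two of its
sides. Up to rotations, every generic orbit of the outer billiard visits it. -/
def strip : Set ℂ := {u | -1 < ht 3 u ∧ ht 3 u < 1 ∧ ht 4 u < -1}

theorem isPreperiodic_or_mem_stripPair {u : ℂ} (hu : u ∈ strip) (hgen : Generic u) :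
    IsPreperiodic (step table) u ∨ ∃ n, ∃ x ∈ Horn, Generic x ∧ u ∈ stripPair n x := by
  obtain ⟨h₃, h₃', h₄⟩ := hu
  obtain ⟨n, hn, hn'⟩ := exists_int_abs_sub_two_mul_lt (hgen 2)
  have hn₀ : 0 ≤ n := by
    have hrec := ht_sub_one_add_ht_add_one 3 u
    rw [show (3 - 1 : ZMod 12) = 2 from rfl, show (3 + 1 : ZMod 12) = 4 from rfl] at hrec
    have : (-1 : ℝ) < n := by nlinarith [lt_sqrt_three, sqrt_three_lt]
    have : -1 < n := by exact_mod_cast this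
    lia
  lift n to ℕ using hn₀
  obtain ⟨x, rfl⟩ : ∃ x, u = 4 * n + x := ⟨u - 4 * n, by ring⟩
  have hgenx : Generic x := by
    simpa using hgen.sub_const (isAlgebraic_four_mul n)
  obtain ⟨e₂, e₃⟩ := ht_four_mul_add n x
  rw [e₂, Int.cast_natCast] at hn hn'
  rw [e₃] at h₃ h₃'
  rcases n.eq_zero_or_pos with rfl | hpos
  · have e₁₀ : ht (-2) x = -ht 4 x := ht_add_six 4 x
    have e₉ : ht (-3) x = -ht 3 x := ht_add_six 3 x
    simp only [Nat.cast_zero, mul_zero, zero_add] at h₄ hn'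
    exact Or.inr ⟨0, x, ⟨by linarith, by linarith, 3, le_rfl, by
      rw [show (1 - (3 : ℕ) : ZMod 12) = -2 from rfl]; linarith⟩, hgenx, Or.inl rfl⟩
  by_cases hx : x ∈ table
  · exact Or.inl (isPreperiodic_four_mul_add_of_mem_table hpos hx hgenx)
  · rcases mem_horn_or_neg_mem_horn hx (by linarith) (by linarith) h₃ h₃' with h | h
    · exact Or.inr ⟨n, x, h, hgenx, Or.inl rfl⟩
    · obtain ⟨m, rfl⟩ := Nat.exists_eq_succ_of_ne_zero hpos.ne'
      exact Or.inr ⟨m, -x, h, hgenx.neg, Or.inr (sub_neg_eq_add _ _).symm⟩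

theorem ae_comp_mul_add {u : ℂ} (hu : ‖u‖ = 1) (w : ℂ) {P : ℂ → Prop} (h : ∀ᵐ z, P z) :
    ∀ᵐ z, P (u * z + w) :=
  (volume_preimage_mul_add hu w {z | ¬P z}).trans h

theorem ae_isPreperiodic_of_mem_strip :
    ∀ᵐ u : ℂ, u ∈ strip → IsPreperiodic (step table) u := by
  have hnull : ∀ᵐ z : ℂ, z ∉ wandering := measure_eq_zero_iff_ae_notMem.1 volume_wandering
  have hadd : ∀ᵐ u : ℂ, ∀ n : ℕ, 1 * u + -(4 * n) ∉ wandering :=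
    ae_all_iff.2 fun n => ae_comp_mul_add norm_one _ hnull
  have hsub : ∀ᵐ u : ℂ, ∀ n : ℕ, -1 * u + 4 * (n + 1 : ℕ) ∉ wandering :=
    ae_all_iff.2 fun n => ae_comp_mul_add (by rw [norm_neg, norm_one]) _ hnull
  filter_upwards [ae_generic, hadd, hsub] with u hgen hadd hsub hu
  rcases isPreperiodic_or_mem_stripPair hu hgen with h | ⟨n, x, hx, hgenx, hux⟩
  · exact h
  refine isPreperiodic_of_mem_stripPair hx hgenx ?_ hux
  by_contra hnot
  rcases hux with rfl | rfl
  · exact hadd n (by simpa using ⟨hx, hgenx, hnot⟩)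
  · exact hsub n (by simpa using ⟨hx, hgenx, hnot⟩)

theorem exists_zeta_mul_add_mem_strip {p : ℂ} (hgen : Generic p) (hp : p ∉ table) :
    ∃ t, ∃ i : ℕ, ζ t * p + -(ζ 1 * i • vert) ∈ strip ∧
      (IsPreperiodic (step table) (ζ t * p + -(ζ 1 * i • vert)) →
        IsPreperiodic (step table) p) := by
  obtain ⟨s, hs⟩ := exists_zeta_mul_mem_wedge hgen hp
  obtain ⟨i, hi, hi'⟩ := exists_int_abs_sub_two_mul_lt (hgen.zeta_mul s 2)
  have hpos : 0 < i := by
    have : (0 : ℝ) < i := by linarith [hs.2]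
    exact_mod_cast this
  lift i to ℕ using hpos.le
  have hone : (1 : ℝ) ≤ i := by exact_mod_cast hpos
  rw [Int.cast_natCast] at hi hi'
  obtain ⟨r, hr⟩ := exists_step_iterate_eq_zeta_mul_sub i hs.1 (by linarith)
  obtain ⟨e₂, e₃⟩ := ht_sub_nsmul_vert (ζ s * p) (2 * i)
  push_cast at e₂ e₃
  have hrot : ζ (1 + s) * p + -(ζ 1 * (2 * i) • vert) = ζ 1 * (ζ s * p - (2 * i) • vert) := by
    rw [AddChar.map_add_eq_mul]
    ring
  refine ⟨1 + s, 2 * i, ?_, fun h => ?_⟩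
  · rw [hrot]
    refine ⟨?_, ?_, ?_⟩ <;> rw [ht_zeta_mul]
    · rwa [show (3 - 1 : ZMod 12) = 2 from rfl, e₂]
    · rwa [show (3 - 1 : ZMod 12) = 2 from rfl, e₂]
    · rw [show (4 - 1 : ZMod 12) = 3 from rfl, e₃]
      linarith [hs.1]
  · rw [hrot, isPreperiodic_zeta_mul_iff, ← isPreperiodic_zeta_mul_iff (s := r), ← hr] at h
    exact isPreperiodic_zeta_mul_iff.1 h.of_iterate

theorem ae_isPeriodic_table : ∀ᵐ p, p ∉ table → IsPeriodic table p := by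
  have hstrip : ∀ᵐ p : ℂ, ∀ t : ZMod 12, ∀ i : ℕ, ζ t * p + -(ζ 1 * i • vert) ∈ strip →
      IsPreperiodic (step table) (ζ t * p + -(ζ 1 * i • vert)) :=
    ae_all_iff.2 fun t => ae_all_iff.2 fun i =>
      ae_comp_mul_add (norm_zeta t) _ ae_isPreperiodic_of_mem_strip
  filter_upwards [ae_generic, hstrip] with p hgen hstrip hp
  obtain ⟨t, i, hmem, hpre⟩ := exists_zeta_mul_add_mem_strip hgen hp
  exact isPeriodic_of_isPreperiodic (outerBilliard_table_dom_iterate hgen hp)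
    (hpre (hstrip t i hmem))

end OuterBilliard

theorem mainTheorem2 (c a : ℂ) (ha : a ≠ 0) :
    ∀ᵐ p ∂(MeasureTheory.volume.restrict (OuterBilliard.regularDodecagon c a)ᶜ),
      OuterBilliard.IsPeriodic (OuterBilliard.regularDodecagon c a) p := by
  have hclosed : IsClosed (OuterBilliard.regularDodecagon c a) :=
    ((Set.finite_range _).isCompact_convexHull ℝ).isClosed
  rw [MeasureTheory.ae_restrict_iff' hclosed.measurableSet.compl,
    OuterBilliard.regularDodecagon_eq_image]
  exact OuterBilliard.ae_isPeriodic_image (div_ne_zero ha OuterBilliard.vert_ne_zero) c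
    OuterBilliard.ae_isPeriodic_table
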